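/- \textbf{Setting.} Let $U\subset\mathbb R^n$ be open and let $\pi=(\pi_{ij})$ be a Poisson structure on $U$, i.e. smooth functions with $\pi_{ji}=-\pi_{ij}$ and $\sum_a \big(\partial_a\pi_{ij}\,\pi_{ak}+\partial_a\pi_{jk}\,\pi_{ai}+\partial_a\pi_{ki}\,\pi_{aj}\big)=0$, with bracket $\{f,g\}_\pi=\sum_{i,j}\pi_{ij}\,\partial_if\,\partial_jg$. On $\mathbb R^n\times\mathbb R^n$ with coordinates $(x,p)$ let $\{F,G\}_\omega=\sum_i(\partial_{x_i}F\,\partial_{p_i}G-\partial_{p_i}F\,\partial_{x_i}G)$. A \emph{bi-realisation} $W\rightrightarrows U$ of $(U,\pi)$ is an open set $W\subset U\times\mathbb R^n$ containing $U\times\{0\}$ with two smooth surjective submersions $\alpha,\beta\colon W\to U$ such that $\alpha(x,0)=\beta(x,0)=x$ and, for all $F,G\in C^\infty(U)$, $$\{F\circ\alpha,G\circ\alpha\}_\omega=\{F,G\}_\pi\circ\alpha,\quad \{F\circ\beta,G\circ\beta\}_\omega=-\{F,G\}_\pi\circ\beta,\quad \{F\circ\alpha,G\circ\beta\}_\omega=0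 .$$ Let $H\in C^\infty(U)$. Define smooth functions $S_i$ on $U$ by $S_1=H$ and, for $i\ge1$, $$S_{i+1}(m)=\frac{d^i}{dt^i}\Big|_{t=0}H\Big(\alpha\big(m,\nabla S^{(i)}_t(m)\big)\Big),\qquad S^{(i)}_t=\sum_{j=1}^i\frac{t^j}{j!}S_j .$$ \textbf{Theorem.} Let $k\ge1$, and let $W\rightrightarrows U$ be a bi-realisation of $(U,\pi)$ with source $\alpha$ and target $\beta$. Consider the scheme: given $x$ and $h$, solve $$\alpha\Big(y,\sum_{i=1}^k\frac{h^i}{i!}\nabla S_i(y)\Big)=x\quad\text{for } y,\qquad\text{and set}\qquad \phi_h(x)=\beta\Big(y,\sum_{i=1}^k\frac{h^i}{i!}\nabla S_i(y)\Big).$$ It is a Poisson Hamiltonian integrator of order $k$ for $\dot x=\pi(x)\nabla H(x)$. Precisely, there are an open neighbourhood $D$ of $\{0\}\times U$ in $\mathbb R\times U$ with $(sh,x)\in D$ whenever $(h,x)\in D$ and $0\le s\le1$, and an open neighbourhood $V$ of $\{0\}\times U$ in $\mathbb R\times\mathbb R^n$, such that for every $(h,x)\in D$ the implicit equation has exactly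 one solution $y=Y(h,x)$ with $(h,y)\in V$, and $Y$ and $(h,x)\mapsto\phi_h(x)\in U$ are smooth on $D$. With $U_h=\{x:(h,x)\in D\}$: \begin{enumerate} \item $\phi_0=\mathrm{id}_U$, and every $\phi_h$ is a diffeomorphism from $U_h$ onto an open subset of $U$; \item if $x\in U$ and $x(h)$ is the solution of $\dot x=\pi(x)\nabla H(x)$ with $x(0)=x$, then $\|\phi_h(x)-x(h)\|=o(h^k)$ as $h\to0$; \item every $\phi_h$ is a Poisson map: $\{F\circ\phi_h,G\circ\phi_h\}_\pi=\{F,G\}_\pi\circ\phi_h$ on $U_h$ for all $F,G\in C^\infty(U)$; \item there is a smooth time-dependent Hamiltonian $(t,x)\mapsto H_t(x)$, defined on an open neighbourhood of $\{0\}\times U$ in $\mathbb R\times U$ which contains all $(h,\phi_h(x))$ with $(h,x)\in D$, such that $\frac{d}{dh}\phi_h(x)=\pi(\phi_h(x))\nabla H_h(\phi_h(x))$ for all $(h,x)\in D$ (so $\phi_h$ is the time-$h$ flow of $(H_t)$), and $H_t-H=O(t^k)$ as $t\to0$, locally uniformly on $U$. \end{enumerate} -/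

import Mathlib

open scoped ContDiff Topology
open Asymptotics Set

/-- The Euclidean space `ℝⁿ`. -/
abbrev Rn (n : ℕ) : Type := EuclideanSpace ℝ (Fin n)

/-- The `i`-th partial derivative of a real function on `ℝⁿ`. -/
noncomputable def pderiv {n : ℕ} (i : Fin n) (f : Rn n → ℝ) (x : Rn n) : ℝ :=
  fderiv ℝ f x (EuclideanSpace.single i 1)

/-- The bracket `{f, g}(x) = ∑ π_{ij}(x) ∂_i f(x) ∂_j g(x)` of a tensor `π`. -/
noncomputable def bracket {n : ℕ} (π : Rn n → Matrix (Fin n) (Fin n) ℝ)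
    (f g : Rn n → ℝ) (x : Rn n) : ℝ :=
  ∑ i, ∑ j, π x i j * pderiv i f x * pderiv j g x

/-- `π` is a Poisson structure on `U`: its coefficients are smooth on `U`, skew-symmetric, and
satisfy the Jacobi identity. -/
structure IsPoissonStructure {n : ℕ} (U : Set (Rn n))
    (π : Rn n → Matrix (Fin n) (Fin n) ℝ) : Prop where
  smooth : ∀ i j, ContDiffOn ℝ ∞ (fun x => π x i j) U
  skew : ∀ x ∈ U, ∀ i j, π x j i = -π x i j
  jacobi : ∀ x ∈ U, ∀ i j k,
    ∑ a, (pderiv a (fun z => π z i j) x * π x a k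
      + pderiv a (fun z => π z j k) x * π x a i
      + pderiv a (fun z => π z k i) x * π x a j) = 0

/-- The Hamiltonian vector field `x ↦ π(x) ∇H(x)`. -/
noncomputable def hamVF {n : ℕ} (π : Rn n → Matrix (Fin n) (Fin n) ℝ) (H : Rn n → ℝ)
    (x : Rn n) : Rn n :=
  WithLp.toLp 2 (Matrix.mulVec (π x) (gradient H x).ofLp)

/-- The canonical bracket on `ℝⁿ × ℝⁿ`, normalised by `{x_i, p_j} = δ_{ij}`. -/
noncomputable def canBracket {n : ℕ} (F G : Rn n × Rn n → ℝ) (w : Rn n × Rn n) : ℝ :=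
  ∑ i : Fin n,
    (fderiv ℝ F w (EuclideanSpace.single i 1, 0) * fderiv ℝ G w (0, EuclideanSpace.single i 1)
      - fderiv ℝ F w (0, EuclideanSpace.single i 1) * fderiv ℝ G w (EuclideanSpace.single i 1, 0))

/-- `W ⇉ U` with source `α` and target `β` is a bi-realisation of `(U, π)`. The values of `α`, `β`
outside `W` play no role. -/
structure IsBiRealisation {n : ℕ} (U : Set (Rn n)) (π : Rn n → Matrix (Fin n) (Fin n) ℝ)
    (W : Set (Rn n × Rn n)) (α β : Rn n × Rn n → Rn n) : Prop where
  isOpen : IsOpen W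
  subset : ∀ w ∈ W, w.1 ∈ U
  zero_mem : ∀ x ∈ U, (x, (0 : Rn n)) ∈ W
  smooth_source : ContDiffOn ℝ ∞ α W
  smooth_target : ContDiffOn ℝ ∞ β W
  image_source : α '' W = U
  image_target : β '' W = U
  submersion_source : ∀ w ∈ W, Function.Surjective (fderiv ℝ α w)
  submersion_target : ∀ w ∈ W, Function.Surjective (fderiv ℝ β w)
  source_zero : ∀ x ∈ U, α (x, 0) = x
  target_zero : ∀ x ∈ U, β (x, 0) = x
  poisson : ∀ F G : Rn n → ℝ, ContDiffOn ℝ ∞ F U → ContDiffOn ℝ ∞ G U →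
    ∀ w ∈ W, canBracket (F ∘ α) (G ∘ α) w = bracket π F G (α w)
  antiPoisson : ∀ F G : Rn n → ℝ, ContDiffOn ℝ ∞ F U → ContDiffOn ℝ ∞ G U →
    ∀ w ∈ W, canBracket (F ∘ β) (G ∘ β) w = -bracket π F G (β w)
  orthogonal : ∀ F G : Rn n → ℝ, ContDiffOn ℝ ∞ F U → ContDiffOn ℝ ∞ G U →
    ∀ w ∈ W, canBracket (F ∘ α) (G ∘ β) w = 0

/-- The terms `S_i` (`i ≥ 1`) of the Hamilton-Jacobi transform `∑ (hⁱ / i!) S_i` of `H`: `S_1 = H`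
and `S_{i+1}(m)` is the `i`-th derivative at `t = 0` of
`H(α(m, ∇ S_t^{(i)}(m)))`, where `S_t^{(i)} = ∑_{1 ≤ j ≤ i} (tʲ / j!) S_j`.
The index `0` is not used. -/
noncomputable def hjTerm {n : ℕ} (α : Rn n × Rn n → Rn n) (H : Rn n → ℝ) : ℕ → Rn n → ℝ
  | 0 => 0
  | 1 => H
  | i + 2 => fun m =>
      iteratedDeriv (i + 1)
        (fun t : ℝ => H (α (m, gradient
          (fun z => ∑ j : Fin (i + 1),
            t ^ ((j : ℕ) + 1) / (((j : ℕ) + 1).factorial : ℝ) * hjTerm α H ((j : ℕ) + 1) z) m))) 0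
termination_by i => i
decreasing_by have := j.isLt; omega

/-- The covector `∑_{1 ≤ i ≤ k} (hⁱ / i!) ∇S_i(y)`. -/
noncomputable def schemeMomentum {n : ℕ} (α : Rn n × Rn n → Rn n) (H : Rn n → ℝ) (k : ℕ)
    (h : ℝ) (y : Rn n) : Rn n :=
  ∑ i ∈ Finset.Icc 1 k, (h ^ i / (i.factorial : ℝ)) • gradient (hjTerm α H i) y

/-- `y` solves the implicit equation `α(y, ∑ (hⁱ / i!) ∇S_i(y)) = x` of the scheme. -/
def SolvesImplicit {n : ℕ} (W : Set (Rn n × Rn n)) (α : Rn n × Rn n → Rn n) (H : Rn n → ℝ)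
    (k : ℕ) (h : ℝ) (x y : Rn n) : Prop :=
  (y, schemeMomentum α H k h y) ∈ W ∧ α (y, schemeMomentum α H k h y) = x

/-- `f` restricts to a diffeomorphism from `A` onto the open set `f '' A`. -/
def IsDiffeoOntoImage {n : ℕ} (f : Rn n → Rn n) (A : Set (Rn n)) : Prop :=
  ContDiffOn ℝ ∞ f A ∧ IsOpen (f '' A) ∧
    ∃ g : Rn n → Rn n, ContDiffOn ℝ ∞ g (f '' A) ∧ ∀ x ∈ A, g (f x) = x

/-- `φ` is an integrator of order `k` on `U` for `ẋ = F(x)`. Its domain `D` is an open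
neighbourhood of `{0} × U` in `ℝ × U`; `φ h` is defined on the slice `U_h = {x | (h, x) ∈ D}`, and
the times at which a given point may be moved form an interval around `0`. Every compact subset of
`U` is contained in `U_h` for all small `h`. -/
structure IsIntegrator {n : ℕ} (U : Set (Rn n)) (F : Rn n → Rn n) (k : ℕ)
    (D : Set (ℝ × Rn n)) (φ : ℝ → Rn n → Rn n) : Prop where
  isOpen : IsOpen D
  subset : ∀ q ∈ D, q.2 ∈ U
  zero_mem : ∀ x ∈ U, ((0 : ℝ), x) ∈ D
  interval : ∀ h x, (h, x) ∈ D → ∀ s ∈ Icc (0 : ℝ) 1, (s * h, x) ∈ D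
  smooth : ContDiffOn ℝ ∞ (Function.uncurry φ) D
  mapsTo : ∀ h x, (h, x) ∈ D → φ h x ∈ U
  map_zero : ∀ x ∈ U, φ 0 x = x
  diffeo : ∀ h, IsDiffeoOntoImage (φ h) {x | (h, x) ∈ D}
  order : ∀ x ∈ U, ∀ c : ℝ → Rn n, c 0 = x → (∀ᶠ t in 𝓝 (0 : ℝ), HasDerivAt c (F (c t)) t) →
    (fun h => φ h x - c h) =o[𝓝 (0 : ℝ)] fun h => h ^ k

/-- A Poisson integrator: an integrator for `ẋ = π(x) ∇H(x)` that preserves the bracket. -/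
structure IsPoissonIntegrator {n : ℕ} (U : Set (Rn n)) (π : Rn n → Matrix (Fin n) (Fin n) ℝ)
    (H : Rn n → ℝ) (k : ℕ) (D : Set (ℝ × Rn n)) (φ : ℝ → Rn n → Rn n) : Prop
    extends IsIntegrator U (hamVF π H) k D φ where
  poisson : ∀ F G : Rn n → ℝ, ContDiffOn ℝ ∞ F U → ContDiffOn ℝ ∞ G U →
    ∀ h x, (h, x) ∈ D → bracket π (F ∘ φ h) (G ∘ φ h) x = bracket π F G (φ h x)

/-- A Poisson Hamiltonian integrator of order `k`: moreover every curve `h ↦ φ h x` is an integral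
curve of a smooth time-dependent Hamiltonian `K` with `K_t - H = O(tᵏ)` locally uniformly on `U`.
The functions `K_t` live on the slices of an open neighbourhood `E` of `{0} × U` in `ℝ × U`. -/
structure IsPoissonHamiltonianIntegrator {n : ℕ} (U : Set (Rn n))
    (π : Rn n → Matrix (Fin n) (Fin n) ℝ) (H : Rn n → ℝ) (k : ℕ)
    (D : Set (ℝ × Rn n)) (φ : ℝ → Rn n → Rn n) : Prop
    extends IsPoissonIntegrator U π H k D φ where
  hamiltonian : ∃ (E : Set (ℝ × Rn n)) (K : ℝ → Rn n → ℝ),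
    IsOpen E ∧ (∀ q ∈ E, q.2 ∈ U) ∧ (∀ x ∈ U, ((0 : ℝ), x) ∈ E) ∧
    ContDiffOn ℝ ∞ (Function.uncurry K) E ∧
    (∀ h x, (h, x) ∈ D → (h, φ h x) ∈ E ∧
      HasDerivAt (fun s => φ s x) (hamVF π (K h) (φ h x)) h) ∧
    (∀ x ∈ U, (fun q : ℝ × Rn n => K q.1 q.2 - H q.2) =O[𝓝 ((0 : ℝ), x)] fun q => q.1 ^ k)

/-!
Write `S_t = ∑_{1 ≤ i ≤ k} (tⁱ / i!) S_i`, `A_t(y) = α(y, ∇S_t(y))` and `B_t(y) = β(y, ∇S_t(y))`.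
Both families are the identity at `t = 0`, so near `{0} × U` they are injective with invertible
derivative (`exists_zeroNhd_injOn`), and the scheme is `φ_t = B_t ∘ A_t⁻¹`.

*Poisson property.* The graph of `∇S_t` is Lagrangian. If `M = dφ_t`, then for every covector `ξ`
the covector `ξ ∘ M ∘ dα - ξ ∘ dβ` vanishes on its tangent space, hence any two such covectors
have zero canonical bracket; expanding this with the bracket relations between `α` and `β` gives
`M π Mᵀ = π ∘ φ_t` (`IsBiRealisation.apply_tensorMap_of_graph`).

*Hamiltonian.* Put `K_t = ∂_t S_t ∘ B_t⁻¹`. For fixed `x`, the point `w` of the graph over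
`A_t⁻¹(x)` moves in a fibre of `α`. The fibres of `α` and `β` are symplectically orthogonal, so
the canonical Hamiltonian vector of `dK_t ∘ dβ` is also tangent to the fibre of `α`; it differs
from `w'` by a vector tangent to the graph. As the graph is transverse to the fibres of `α`, the two
vectors coincide, and applying `dβ` gives `∂_t φ_t = π ∇K_t` at `φ_t`
(`IsBiRealisation.target_velocity`).

*Order.* By the recursion for the `S_i`, the functions `∂_t S_t` and `H ∘ A_t` have the same Taylor
coefficients at `t = 0` up to degree `k - 1` (`vanishesToOrder_hamiltonJacobi`). Therefore
`K_t ∘ φ_t = H + O(tᵏ)`. Since `dH(π ∇H) = 0`, the time derivative of `H ∘ φ_t` is bounded by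
`d(K_t - H)`; so if `K_t - H = O(tʲ)` with `j < k`, then `H ∘ φ_t - H = O(tʲ⁺¹)` and
`K_t - H = O(tʲ⁺¹)`. Iteration gives `K_t - H = O(tᵏ)` (`IsSchemeInverse.vanishesToOrder`), and
Grönwall's inequality turns this into the order estimate for `φ_t`. In these arguments `O(tʲ)` is
encoded as the vanishing of the time derivatives of order below `j` on `{0} × U`
(`VanishesToOrder`), which is stable under products, space derivatives and substitutions.
-/

/-! ### Functions of time and space vanishing to finite order in time -/

section TimeJets

set_option linter.unusedSectionVars false

variable {E E' F G₁ G₂ : Type} [NormedAddCommGroup E] [NormedSpace ℝ E]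
  [NormedAddCommGroup E'] [NormedSpace ℝ E'] [NormedAddCommGroup F] [NormedSpace ℝ F]
  [NormedAddCommGroup G₁] [NormedSpace ℝ G₁] [NormedAddCommGroup G₂] [NormedSpace ℝ G₂]

/-- `O` is an open neighbourhood of `{0} × U` in `ℝ × E`. -/
structure IsZeroNhd (U : Set E) (O : Set (ℝ × E)) : Prop where
  isOpen : IsOpen O
  zero_mem : ∀ z ∈ U, ((0 : ℝ), z) ∈ O

/-- The partial derivative `∂_t f` of a function of time and space, taken along the line through the
space point, so that its iterates are the `iteratedDeriv` of `t ↦ f (t, z)`. -/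
noncomputable def timeDeriv (f : ℝ × E → F) (q : ℝ × E) : F := deriv (fun s => f (s, q.2)) q.1

/-- The partial derivative of a function of time and space in the space variable. -/
noncomputable def spaceDeriv (f : ℝ × E → F) (q : ℝ × E) : E →L[ℝ] F :=
  fderiv ℝ (fun z => f (q.1, z)) q.2

/-- All the derivatives `∂_t^i f` with `i < j` vanish on `{0} × U`. -/
def VanishesToOrder (U : Set E) (j : ℕ) (f : ℝ × E → F) : Prop :=
  ∀ i < j, ∀ z ∈ U, iteratedDeriv i (fun t => f (t, z)) 0 = 0

theorem vanishesToOrder_zero (U : Set E) (f : ℝ × E → F) : VanishesToOrder U 0 f :=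
  fun _ hi => absurd hi (Nat.not_lt_zero _)

theorem vanishesToOrder_succ {U : Set E} {j : ℕ} {f : ℝ × E → F} :
    VanishesToOrder U (j + 1) f ↔
      (∀ z ∈ U, f (0, z) = 0) ∧ VanishesToOrder U j (timeDeriv f) := by
  constructor
  · intro h
    refine ⟨fun z hz => by simpa using h 0 (Nat.succ_pos _) z hz, fun i hi z hz => ?_⟩
    have := h (i + 1) (by omega) z hz
    rwa [iteratedDeriv_succ'] at this
  · rintro ⟨h0, h1⟩ i hi z hz
    cases i with
    | zero => simpa using h0 z hz
    | succ i =>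
      rw [iteratedDeriv_succ']
      exact h1 i (by omega) z hz

theorem VanishesToOrder.mono {U : Set E} {i j : ℕ} {f : ℝ × E → F} (h : VanishesToOrder U j f)
    (hij : i ≤ j) : VanishesToOrder U i f :=
  fun l hl => h l (hl.trans_le hij)

theorem IsZeroNhd.eventually {U : Set E} {O : Set (ℝ × E)} (hO : IsZeroNhd U O) {z : E}
    (hz : z ∈ U) : ∀ᶠ t in 𝓝 (0 : ℝ), (t, z) ∈ O :=
  (Continuous.prodMk_left z).continuousAt.eventually_mem (hO.isOpen.mem_nhds (hO.zero_mem z hz))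

theorem VanishesToOrder.congr {U : Set E} {O : Set (ℝ × E)} (hO : IsZeroNhd U O) {j : ℕ}
    {f g : ℝ × E → F} (h : VanishesToOrder U j f) (hfg : ∀ q ∈ O, f q = g q) :
    VanishesToOrder U j g := by
  intro i hi z hz
  rw [← h i hi z hz]
  refine Filter.EventuallyEq.iteratedDeriv_eq i ?_
  filter_upwards [hO.eventually hz] with t ht using (hfg _ ht).symm

theorem hasFDerivAt_of_contDiffOn {f : E → F} {O : Set E} (hO : IsOpen O)
    (hf : ContDiffOn ℝ ∞ f O) {q : E} (hq : q ∈ O) : HasFDerivAt f (fderiv ℝ f q) q :=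
  ((hf.contDiffAt (hO.mem_nhds hq)).differentiableAt (by simp)).hasFDerivAt

theorem hasDerivAt_time {f : ℝ × E → F} {f' : ℝ × E →L[ℝ] F} {q : ℝ × E}
    (hf : HasFDerivAt f f' q) : HasDerivAt (fun s => f (s, q.2)) (f' (1, 0)) q.1 := by
  have h : HasDerivAt (fun s : ℝ => (s, q.2)) ((1 : ℝ), (0 : E)) q.1 :=
    (hasDerivAt_id q.1).prodMk (hasDerivAt_const _ _)
  exact hf.comp_hasDerivAt q.1 h

theorem hasFDerivAt_space {f : ℝ × E → F} {f' : ℝ × E →L[ℝ] F} {q : ℝ × E}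
    (hf : HasFDerivAt f f' q) :
    HasFDerivAt (fun z => f (q.1, z)) (f'.comp (ContinuousLinearMap.inr ℝ ℝ E)) q.2 :=
  HasFDerivAt.comp q.2 hf (hasFDerivAt_prodMk_right q.1 q.2)

theorem timeDeriv_eq {f : ℝ × E → F} {O : Set (ℝ × E)} (hO : IsOpen O)
    (hf : ContDiffOn ℝ ∞ f O) {q : ℝ × E} (hq : q ∈ O) :
    timeDeriv f q = fderiv ℝ f q (1, 0) :=
  (hasDerivAt_time (hasFDerivAt_of_contDiffOn hO hf hq)).deriv

theorem hasDerivAt_timeDeriv {f : ℝ × E → F} {O : Set (ℝ × E)} (hO : IsOpen O)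
    (hf : ContDiffOn ℝ ∞ f O) {q : ℝ × E} (hq : q ∈ O) :
    HasDerivAt (fun s => f (s, q.2)) (timeDeriv f q) q.1 :=
  (hasDerivAt_time (hasFDerivAt_of_contDiffOn hO hf hq)).differentiableAt.hasDerivAt

theorem spaceDeriv_eq {f : ℝ × E → F} {O : Set (ℝ × E)} (hO : IsOpen O)
    (hf : ContDiffOn ℝ ∞ f O) {q : ℝ × E} (hq : q ∈ O) :
    spaceDeriv f q = (fderiv ℝ f q).comp (ContinuousLinearMap.inr ℝ ℝ E) :=
  (hasFDerivAt_space (hasFDerivAt_of_contDiffOn hO hf hq)).fderiv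

theorem hasFDerivAt_spaceDeriv {f : ℝ × E → F} {O : Set (ℝ × E)} (hO : IsOpen O)
    (hf : ContDiffOn ℝ ∞ f O) {q : ℝ × E} (hq : q ∈ O) :
    HasFDerivAt (fun z => f (q.1, z)) (spaceDeriv f q) q.2 :=
  (hasFDerivAt_space (hasFDerivAt_of_contDiffOn hO hf hq)).differentiableAt.hasFDerivAt

theorem fderiv_apply_eq {f : ℝ × E → F} {O : Set (ℝ × E)} (hO : IsOpen O)
    (hf : ContDiffOn ℝ ∞ f O) {q : ℝ × E} (hq : q ∈ O) (s : ℝ) (v : E) :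
    fderiv ℝ f q (s, v) = s • timeDeriv f q + spaceDeriv f q v := by
  rw [timeDeriv_eq hO hf hq, spaceDeriv_eq hO hf hq, ← map_smul]
  simp only [ContinuousLinearMap.comp_apply, ContinuousLinearMap.inr_apply, ← map_add]
  simp

theorem contDiffOn_timeDeriv {f : ℝ × E → F} {O : Set (ℝ × E)} (hO : IsOpen O)
    (hf : ContDiffOn ℝ ∞ f O) : ContDiffOn ℝ ∞ (timeDeriv f) O :=
  ((hf.fderiv_of_isOpen hO (m := ∞) (by simp)).clm_apply contDiffOn_const).congr
    fun _ hq => timeDeriv_eq hO hf hq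

theorem contDiffOn_spaceDeriv {f : ℝ × E → F} {O : Set (ℝ × E)} (hO : IsOpen O)
    (hf : ContDiffOn ℝ ∞ f O) : ContDiffOn ℝ ∞ (spaceDeriv f) O :=
  ((hf.fderiv_of_isOpen hO (m := ∞) (by simp)).clm_comp contDiffOn_const).congr
    fun _ hq => spaceDeriv_eq hO hf hq

theorem isSymmSndFDerivAt_of_contDiffOn {f : E → F} {O : Set E} (hO : IsOpen O)
    (hf : ContDiffOn ℝ ∞ f O) {q : E} (hq : q ∈ O) : IsSymmSndFDerivAt ℝ f q :=
  (hf.contDiffAt (hO.mem_nhds hq)).isSymmSndFDerivAt (by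
    simpa using ((by exact_mod_cast le_top) : ((2 : ℕ∞) : WithTop ℕ∞) ≤ ∞))

theorem hasFDerivAt_fderiv_apply {f : E → F} {O : Set E} (hO : IsOpen O)
    (hf : ContDiffOn ℝ ∞ f O) {q : E} (hq : q ∈ O) (v : E) :
    HasFDerivAt (fun p => fderiv ℝ f p v) ((fderiv ℝ (fderiv ℝ f) q).flip v) q := by
  have h := hasFDerivAt_of_contDiffOn hO (hf.fderiv_of_isOpen hO (m := ∞) (by simp)) hq
  refine (h.clm_apply (hasFDerivAt_const v q)).congr_fderiv ?_
  ext u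
  simp

/-- Time and space derivatives commute: both sides are second derivatives of `f`. -/
theorem timeDeriv_spaceDeriv {f : ℝ × E → F} {O : Set (ℝ × E)} (hO : IsOpen O)
    (hf : ContDiffOn ℝ ∞ f O) {q : ℝ × E} (hq : q ∈ O) :
    timeDeriv (spaceDeriv f) q = spaceDeriv (timeDeriv f) q := by
  ext v
  have h1 : spaceDeriv (timeDeriv f) q v = fderiv ℝ (fderiv ℝ f) q (0, v) (1, 0) := by
    rw [spaceDeriv_eq hO (contDiffOn_timeDeriv hO hf) hq]
    have : timeDeriv f =ᶠ[𝓝 q] fun p => fderiv ℝ f p (1, 0) := by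
      filter_upwards [hO.mem_nhds hq] with p hp using timeDeriv_eq hO hf hp
    rw [this.fderiv_eq, (hasFDerivAt_fderiv_apply hO hf hq _).fderiv]
    simp
  have h2 : timeDeriv (spaceDeriv f) q v = fderiv ℝ (fderiv ℝ f) q (1, 0) (0, v) := by
    have hd := hasDerivAt_timeDeriv hO (contDiffOn_spaceDeriv hO hf) hq
    have hd' := hd.clm_apply (hasDerivAt_const q.1 v)
    have hd2 := hasDerivAt_time (hasFDerivAt_fderiv_apply hO hf hq ((0 : ℝ), v))
    have he : (fun s => spaceDeriv f (s, q.2) v) =ᶠ[𝓝 q.1]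
        fun s => fderiv ℝ f (s, q.2) (0, v) := by
      have : ∀ᶠ s in 𝓝 q.1, (s, q.2) ∈ O :=
        (Continuous.prodMk_left q.2).continuousAt.eventually_mem (hO.mem_nhds hq)
      filter_upwards [this] with s hs
      rw [spaceDeriv_eq hO hf hs]; simp
    simpa using hd'.unique (hd2.congr_of_eventuallyEq he)
  rw [h1, h2]
  exact (isSymmSndFDerivAt_of_contDiffOn hO hf hq).eq _ _

theorem contDiffAt_time {f : ℝ × E → F} {O : Set (ℝ × E)} (hO : IsOpen O)
    (hf : ContDiffOn ℝ ∞ f O) {q : ℝ × E} (hq : q ∈ O) :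
    ContDiffAt ℝ ∞ (fun s => f (s, q.2)) q.1 :=
  ContDiffAt.comp q.1 (hf.contDiffAt (hO.mem_nhds hq))
    (contDiffAt_id.prodMk contDiffAt_const)

theorem contDiffOn_iteratedDeriv_time {f : ℝ × E → F} {O : Set (ℝ × E)} (hO : IsOpen O)
    (hf : ContDiffOn ℝ ∞ f O) (i : ℕ) :
    ContDiffOn ℝ ∞ (fun q : ℝ × E => iteratedDeriv i (fun t => f (t, q.2)) q.1) O := by
  induction i generalizing f with
  | zero => simpa using hf
  | succ i ih =>
    simp only [iteratedDeriv_succ']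
    exact ih (contDiffOn_timeDeriv hO hf)

variable {U : Set E} {O : Set (ℝ × E)} {j : ℕ}

theorem vanishesToOrder_sub_iff (hO : IsZeroNhd U O) {f g : ℝ × E → F}
    (hf : ContDiffOn ℝ ∞ f O) (hg : ContDiffOn ℝ ∞ g O) :
    VanishesToOrder U j (fun q => f q - g q) ↔ ∀ i < j, ∀ z ∈ U,
      iteratedDeriv i (fun t => f (t, z)) 0 = iteratedDeriv i (fun t => g (t, z)) 0 := by
  refine forall₄_congr fun i _ z hz => ?_
  have h := iteratedDeriv_sub (n := i) (x := (0 : ℝ))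
    ((contDiffAt_time hO.isOpen hf (hO.zero_mem z hz)).of_le (by exact_mod_cast le_top))
    ((contDiffAt_time hO.isOpen hg (hO.zero_mem z hz)).of_le (by exact_mod_cast le_top))
  rw [← sub_eq_zero (b := iteratedDeriv i (fun t => g (t, z)) 0), ← h]
  rfl

theorem VanishesToOrder.add (hO : IsZeroNhd U O) {f g : ℝ × E → F}
    (hf : ContDiffOn ℝ ∞ f O) (hg : ContDiffOn ℝ ∞ g O)
    (h1 : VanishesToOrder U j f) (h2 : VanishesToOrder U j g) :
    VanishesToOrder U j (fun q => f q + g q) := by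
  intro i hi z hz
  have h := iteratedDeriv_add (n := i) (x := (0 : ℝ))
    ((contDiffAt_time hO.isOpen hf (hO.zero_mem z hz)).of_le (by exact_mod_cast le_top))
    ((contDiffAt_time hO.isOpen hg (hO.zero_mem z hz)).of_le (by exact_mod_cast le_top))
  rw [h1 i hi z hz, h2 i hi z hz, add_zero] at h
  exact h

theorem VanishesToOrder.spaceDeriv (hU : IsOpen U) (hO : IsZeroNhd U O) {f : ℝ × E → F}
    (hf : ContDiffOn ℝ ∞ f O) (h : VanishesToOrder U j f) :
    VanishesToOrder U j (spaceDeriv f) := by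
  induction j generalizing f with
  | zero => exact vanishesToOrder_zero _ _
  | succ j ih =>
    rw [vanishesToOrder_succ] at h ⊢
    refine ⟨fun z hz => ?_, (ih (contDiffOn_timeDeriv hO.isOpen hf) h.2).congr hO
      fun q hq => (timeDeriv_spaceDeriv hO.isOpen hf hq).symm⟩
    have : (fun z => f ((0 : ℝ), z)) =ᶠ[𝓝 z] fun _ => 0 := by
      filter_upwards [hU.mem_nhds hz] with y hy using h.1 y hy
    change fderiv ℝ (fun z => f ((0 : ℝ), z)) z = 0
    rw [this.fderiv_eq]
    simp

theorem contDiffOn_bilin (B : F →L[ℝ] G₁ →L[ℝ] G₂) {f : ℝ × E → F} {g : ℝ × E → G₁}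
    (hf : ContDiffOn ℝ ∞ f O) (hg : ContDiffOn ℝ ∞ g O) :
    ContDiffOn ℝ ∞ (fun q => B (f q) (g q)) O :=
  (B.contDiff.comp_contDiffOn hf).clm_apply hg

theorem VanishesToOrder.bilin_left (hO : IsZeroNhd U O) (B : F →L[ℝ] G₁ →L[ℝ] G₂)
    {f : ℝ × E → F} {g : ℝ × E → G₁} (hf : ContDiffOn ℝ ∞ f O) (hg : ContDiffOn ℝ ∞ g O)
    (h : VanishesToOrder U j f) : VanishesToOrder U j (fun q => B (f q) (g q)) := by
  induction j generalizing f g with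
  | zero => exact vanishesToOrder_zero _ _
  | succ j ih =>
    have h' := h.mono (Nat.le_succ j)
    rw [vanishesToOrder_succ] at h ⊢
    refine ⟨fun z hz => by simp [h.1 z hz], ?_⟩
    have hf' := contDiffOn_timeDeriv hO.isOpen hf
    have hg' := contDiffOn_timeDeriv hO.isOpen hg
    refine VanishesToOrder.congr hO (VanishesToOrder.add hO (contDiffOn_bilin B hf hg')
      (contDiffOn_bilin B hf' hg) (ih hf hg' h') (ih hf' hg h.2)) fun q hq => ?_
    have hd := ((B.hasFDerivAt.comp_hasDerivAt q.1
      (hasDerivAt_timeDeriv hO.isOpen hf hq)).clm_apply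
      (hasDerivAt_timeDeriv hO.isOpen hg hq)).deriv
    rw [add_comm]
    exact hd.symm

theorem VanishesToOrder.bilin_right (hO : IsZeroNhd U O) (B : F →L[ℝ] G₁ →L[ℝ] G₂)
    {f : ℝ × E → F} {g : ℝ × E → G₁} (hf : ContDiffOn ℝ ∞ f O) (hg : ContDiffOn ℝ ∞ g O)
    (h : VanishesToOrder U j g) : VanishesToOrder U j (fun q => B (f q) (g q)) :=
  VanishesToOrder.bilin_left hO B.flip hg hf h

theorem timeDeriv_comp_space {O' : Set (ℝ × E)} (hO : IsOpen O) (hO' : IsOpen O')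
    {f : ℝ × E → F} {ψ : ℝ × E → E} (hf : ContDiffOn ℝ ∞ f O) (hψ : ContDiffOn ℝ ∞ ψ O')
    {q : ℝ × E} (hq : q ∈ O') (hψq : (q.1, ψ q) ∈ O) :
    timeDeriv (fun q => f (q.1, ψ q)) q =
      timeDeriv f (q.1, ψ q) + spaceDeriv f (q.1, ψ q) (timeDeriv ψ q) := by
  have hd := ((hasFDerivAt_of_contDiffOn hO hf hψq).comp_hasDerivAt q.1
    ((hasDerivAt_id q.1).prodMk (hasDerivAt_timeDeriv hO' hψ hq))).deriv
  rw [fderiv_apply_eq hO hf hψq, one_smul] at hd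
  exact hd

theorem spaceDeriv_comp_space {O' : Set (ℝ × E)} (hO : IsOpen O) (hO' : IsOpen O')
    {f : ℝ × E → F} {ψ : ℝ × E → E} (hf : ContDiffOn ℝ ∞ f O) (hψ : ContDiffOn ℝ ∞ ψ O')
    {q : ℝ × E} (hq : q ∈ O') (hψq : (q.1, ψ q) ∈ O) :
    spaceDeriv (fun q => f (q.1, ψ q)) q =
      (spaceDeriv f (q.1, ψ q)).comp (spaceDeriv ψ q) :=
  (HasFDerivAt.comp (g := fun z => f (q.1, z)) (f := fun z => ψ (q.1, z)) q.2
    (hasFDerivAt_spaceDeriv hO hf hψq)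
    (hasFDerivAt_spaceDeriv hO' hψ hq)).fderiv

theorem timeDeriv_congr (hO : IsOpen O) {f g : ℝ × E → F} (h : ∀ q ∈ O, f q = g q)
    {q : ℝ × E} (hq : q ∈ O) : timeDeriv f q = timeDeriv g q := by
  refine Filter.EventuallyEq.deriv_eq ?_
  filter_upwards [(Continuous.prodMk_left q.2).continuousAt.eventually_mem (hO.mem_nhds hq)]
    with s hs using h _ hs

theorem spaceDeriv_congr (hO : IsOpen O) {f g : ℝ × E → F} (h : ∀ q ∈ O, f q = g q)
    {q : ℝ × E} (hq : q ∈ O) : spaceDeriv f q = spaceDeriv g q := by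
  refine Filter.EventuallyEq.fderiv_eq ?_
  filter_upwards [(Continuous.prodMk_right q.1).continuousAt.eventually_mem (hO.mem_nhds hq)]
    with z hz using h _ hz

/-- Vanishing to order `j` in time is preserved by a change of the space variable that is the
identity at time `0`. -/
theorem VanishesToOrder.comp_space {O' : Set (ℝ × E)} (hU : IsOpen U)
    (hO : IsZeroNhd U O) (hO' : IsZeroNhd U O')
    {f : ℝ × E → F} {ψ : ℝ × E → E} (hf : ContDiffOn ℝ ∞ f O) (hψ : ContDiffOn ℝ ∞ ψ O')
    (hmaps : ∀ q ∈ O', (q.1, ψ q) ∈ O) (hψ0 : ∀ z ∈ U, ψ (0, z) = z)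
    (h : VanishesToOrder U j f) : VanishesToOrder U j (fun q => f (q.1, ψ q)) := by
  have hcomp : ∀ {H : Type} [NormedAddCommGroup H] [NormedSpace ℝ H] {g : ℝ × E → H},
      ContDiffOn ℝ ∞ g O → ContDiffOn ℝ ∞ (fun q => g (q.1, ψ q)) O' :=
    fun hg => hg.comp (contDiffOn_fst.prodMk hψ) hmaps
  induction j generalizing F with
  | zero => exact vanishesToOrder_zero _ _
  | succ j ih =>
    have h' := h.mono (Nat.le_succ j)
    rw [vanishesToOrder_succ] at h ⊢
    refine ⟨fun z hz => by simp [hψ0 z hz, h.1 z hz], ?_⟩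
    have hft := contDiffOn_timeDeriv hO.isOpen hf
    have hfx := contDiffOn_spaceDeriv hO.isOpen hf
    have hψt := contDiffOn_timeDeriv hO'.isOpen hψ
    let B : (E →L[ℝ] F) →L[ℝ] E →L[ℝ] F := ContinuousLinearMap.id ℝ _
    have h1 : VanishesToOrder U j fun q => B (_root_.spaceDeriv f (q.1, ψ q)) (timeDeriv ψ q) :=
      VanishesToOrder.bilin_left hO' B (hcomp hfx) hψt (ih hfx (h'.spaceDeriv hU hO hf))
    refine ((ih hft h.2).add hO' (hcomp hft)
      (contDiffOn_bilin B (hcomp hfx) hψt) h1).congr hO' fun q hq => ?_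
    exact (timeDeriv_comp_space hO.isOpen hO'.isOpen hf hψ hq (hmaps q hq)).symm

/-- A smooth function vanishing to order `j` in time is `O(tʲ)`, locally uniformly in space. -/
theorem VanishesToOrder.isBigO (hU : IsOpen U) (hO : IsZeroNhd U O) {f : ℝ × E → F}
    (hf : ContDiffOn ℝ ∞ f O) (h : VanishesToOrder U j f) {x : E} (hx : x ∈ U) :
    f =O[𝓝 ((0 : ℝ), x)] fun q => q.1 ^ j := by
  induction j generalizing f with
  | zero =>
    simpa using ((hf.continuousOn.continuousAt
      (hO.isOpen.mem_nhds (hO.zero_mem x hx))).isBigO_one ℝ)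
  | succ j ih =>
    rw [vanishesToOrder_succ] at h
    obtain ⟨C, hC0, hC⟩ := (ih (contDiffOn_timeDeriv hO.isOpen hf) h.2).exists_nonneg
    obtain ⟨r, hr, hball⟩ := Metric.eventually_nhds_iff_ball.1
      (hC.bound.and ((hO.isOpen.eventually_mem (hO.zero_mem x hx)).and
        ((continuous_snd.continuousAt (x := ((0 : ℝ), x))).eventually_mem (hU.mem_nhds hx))))
    refine IsBigO.of_bound C ?_
    filter_upwards [Metric.ball_mem_nhds _ hr] with q hq
    have hmem : ∀ s ∈ uIcc (0 : ℝ) q.1, (s, q.2) ∈ Metric.ball ((0 : ℝ), x) r ∧ |s| ≤ |q.1| := by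
      intro s hs
      have hs' : |s| ≤ |q.1| := by simpa using abs_sub_left_of_mem_uIcc hs
      refine ⟨?_, hs'⟩
      rw [Metric.mem_ball, Prod.dist_eq, max_lt_iff] at hq ⊢
      exact ⟨lt_of_le_of_lt (by simpa [Real.dist_eq] using hs') hq.1, hq.2⟩
    have hmv := Convex.norm_image_sub_le_of_norm_deriv_le (f := fun s => f (s, q.2))
      (s := uIcc (0 : ℝ) q.1) (x := 0) (y := q.1) (C := C * |q.1| ^ j)
      (fun s hs => (hasDerivAt_timeDeriv hO.isOpen hf
        (hball _ (hmem s hs).1).2.1).differentiableAt)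
      (fun s hs => ((hball _ (hmem s hs).1).1).trans (by
        rw [norm_pow, Real.norm_eq_abs]
        have := (hmem s hs).2
        gcongr)) (convex_uIcc _ _) left_mem_uIcc right_mem_uIcc
    have h0 : f (0, q.2) = 0 := h.1 _ (hball _ hq).2.2
    simpa [h0, pow_succ, mul_assoc] using hmv

/-- If `P` and `Q` agree to order `j` in time, then so do `f(z, P(t, z))` and `f(z, Q(t, z))`. -/
theorem VanishesToOrder.comp_sub {W : Set (E × E')} (hW : IsOpen W) (hO : IsZeroNhd U O)
    {f : E × E' → F} {P Q : ℝ × E → E'} (hf : ContDiffOn ℝ ∞ f W) (hP : ContDiffOn ℝ ∞ P O)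
    (hQ : ContDiffOn ℝ ∞ Q O) (hPW : ∀ q ∈ O, (q.2, P q) ∈ W) (hQW : ∀ q ∈ O, (q.2, Q q) ∈ W)
    (h : VanishesToOrder U j (fun q => P q - Q q)) :
    VanishesToOrder U j (fun q => f (q.2, P q) - f (q.2, Q q)) := by
  have hcomp : ∀ {H : Type} [NormedAddCommGroup H] [NormedSpace ℝ H] {g : E × E' → H}
      {R : ℝ × E → E'}, ContDiffOn ℝ ∞ g W → ContDiffOn ℝ ∞ R O → (∀ q ∈ O, (q.2, R q) ∈ W) →
      ContDiffOn ℝ ∞ (fun q => g (q.2, R q)) O :=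
    fun hg hR hRW => hg.comp (contDiffOn_snd.prodMk hR) hRW
  induction j generalizing F with
  | zero => exact vanishesToOrder_zero _ _
  | succ j ih =>
    have h' := h.mono (Nat.le_succ j)
    rw [vanishesToOrder_succ] at h ⊢
    refine ⟨fun z hz => by simp [sub_eq_zero.1 (h.1 z hz)], ?_⟩
    have hPt := contDiffOn_timeDeriv hO.isOpen hP
    have hQt := contDiffOn_timeDeriv hO.isOpen hQ
    -- the derivative of `f` in its second argument
    let g : E × E' → E' →L[ℝ] F := fun w => (fderiv ℝ f w).comp (ContinuousLinearMap.inr ℝ E E')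
    have hg : ContDiffOn ℝ ∞ g W :=
      (hf.fderiv_of_isOpen hW (m := ∞) (by simp)).clm_comp contDiffOn_const
    have hd : ∀ {R : ℝ × E → E'}, ContDiffOn ℝ ∞ R O → ∀ q ∈ O, (q.2, R q) ∈ W →
        timeDeriv (fun q => f (q.2, R q)) q = g (q.2, R q) (timeDeriv R q) := by
      intro R hR q hq hRW
      exact ((hasFDerivAt_of_contDiffOn hW hf hRW).comp_hasDerivAt q.1
        ((hasDerivAt_const q.1 q.2).prodMk (hasDerivAt_timeDeriv hO.isOpen hR hq))).deriv
    let B : (E' →L[ℝ] F) →L[ℝ] E' →L[ℝ] F := ContinuousLinearMap.id ℝ _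
    have h2 : VanishesToOrder U j fun q => timeDeriv P q - timeDeriv Q q := by
      refine h.2.congr hO fun q hq => ?_
      exact ((hasDerivAt_timeDeriv hO.isOpen hP hq).sub
        (hasDerivAt_timeDeriv hO.isOpen hQ hq)).deriv
    refine ((VanishesToOrder.bilin_left hO B ((hcomp hg hP hPW).sub (hcomp hg hQ hQW)) hPt
      (ih hg h')).add hO (contDiffOn_bilin B ((hcomp hg hP hPW).sub (hcomp hg hQ hQW)) hPt)
      (contDiffOn_bilin B (hcomp hg hQ hQW) (hPt.sub hQt))
      (VanishesToOrder.bilin_right hO B (hcomp hg hQ hQW) (hPt.sub hQt) h2)).congr hO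
        fun q hq => ?_
    have h3 : timeDeriv (fun q => f (q.2, P q) - f (q.2, Q q)) q =
        timeDeriv (fun q => f (q.2, P q)) q - timeDeriv (fun q => f (q.2, Q q)) q :=
      ((hasDerivAt_timeDeriv hO.isOpen (hcomp hf hP hPW) hq).sub
        (hasDerivAt_timeDeriv hO.isOpen (hcomp hf hQ hQW) hq)).deriv
    rw [h3, hd hP q hq (hPW q hq), hd hQ q hq (hQW q hq)]
    simp [B]

end TimeJets

/-! ### Inverting a family of maps near the identity -/

section Inverse

set_option linter.unusedSectionVars false

variable {E : Type} [NormedAddCommGroup E] [NormedSpace ℝ E] [CompleteSpace E]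

/-- An injective smooth map with invertible derivative is open and has a smooth inverse. -/
theorem exists_contDiffOn_inverse {Φ : E → E} {V : Set E} (hV : IsOpen V)
    (hΦ : ContDiffOn ℝ ∞ Φ V) (hinj : InjOn Φ V)
    (hinv : ∀ q ∈ V, fderiv ℝ Φ q ∈ range ((↑) : (E ≃L[ℝ] E) → E →L[ℝ] E)) :
    IsOpen (Φ '' V) ∧ ∃ Ψ : E → E, ContDiffOn ℝ ∞ Ψ (Φ '' V) ∧ ∀ q ∈ V, Ψ (Φ q) = q := by
  have hΨ := hinj.leftInvOn_invFunOn
  have key : ∀ q ∈ V, Φ '' V ∈ 𝓝 (Φ q) ∧ ContDiffAt ℝ ∞ (Function.invFunOn Φ V) (Φ q) := by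
    intro q hq
    obtain ⟨e, he⟩ := hinv q hq
    have hat := hΦ.contDiffAt (hV.mem_nhds hq)
    have hd : HasFDerivAt Φ (e : E →L[ℝ] E) q := he ▸ hasFDerivAt_of_contDiffOn hV hΦ hq
    have hs := hat.hasStrictFDerivAt' hd (by simp)
    have hg : ContDiffAt ℝ ∞ (hs.localInverse Φ e q) (Φ q) := hat.to_localInverse hd (by simp)
    have hgV : ∀ᶠ p in 𝓝 (Φ q), hs.localInverse Φ e q p ∈ V :=
      hg.continuousAt.eventually_mem (by
        rw [hs.localInverse_apply_image]; exact hV.mem_nhds hq)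
    refine ⟨?_, hg.congr_of_eventuallyEq ?_⟩
    · filter_upwards [hgV, hs.eventually_right_inverse] with p h1 h2 using ⟨_, h1, h2⟩
    · filter_upwards [hgV, hs.eventually_right_inverse] with p h1 h2
      have := hΨ h1
      rwa [h2] at this
  refine ⟨isOpen_iff_mem_nhds.2 ?_, Function.invFunOn Φ V, ?_, hΨ⟩
  · rintro _ ⟨q, hq, rfl⟩
    exact (key q hq).1
  · rintro _ ⟨q, hq, rfl⟩
    exact (key q hq).2.contDiffWithinAt

theorem fderiv_prodMk_fst_mem_range {G : ℝ × E → E} {U : Set E} {O : Set (ℝ × E)} (hU : IsOpen U)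
    (hO : IsZeroNhd U O) (hG : ContDiffOn ℝ ∞ G O) (h0 : ∀ y ∈ U, G (0, y) = y) {x : E}
    (hx : x ∈ U) : fderiv ℝ (fun q => (q.1, G q)) ((0 : ℝ), x) ∈
      range ((↑) : ((ℝ × E) ≃L[ℝ] (ℝ × E)) → (ℝ × E) →L[ℝ] (ℝ × E)) := by
  have hmem := hO.zero_mem x hx
  have hGd := hasFDerivAt_of_contDiffOn hO.isOpen hG hmem
  have hspace : spaceDeriv G ((0 : ℝ), x) = ContinuousLinearMap.id ℝ E := by
    have : (fun z => G ((0 : ℝ), z)) =ᶠ[𝓝 x] id := by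
      filter_upwards [hU.mem_nhds hx] with y hy using h0 y hy
    change fderiv ℝ (fun z => G ((0 : ℝ), z)) x = _
    rw [this.fderiv_eq, fderiv_id]
  have hd : HasFDerivAt (fun q : ℝ × E => (q.1, G q))
      ((ContinuousLinearMap.fst ℝ ℝ E).prod (fderiv ℝ G ((0 : ℝ), x))) ((0 : ℝ), x) :=
    hasFDerivAt_fst.prodMk hGd
  rw [hd.fderiv]
  refine ⟨ContinuousLinearEquiv.equivOfInverse
    ((ContinuousLinearMap.fst ℝ ℝ E).prod (fderiv ℝ G ((0 : ℝ), x)))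
    ((ContinuousLinearMap.fst ℝ ℝ E).prod (ContinuousLinearMap.snd ℝ ℝ E -
      (ContinuousLinearMap.fst ℝ ℝ E).smulRight (timeDeriv G ((0 : ℝ), x)))) ?_ ?_, rfl⟩
  · rintro ⟨s, v⟩
    simp [fderiv_apply_eq hO.isOpen hG hmem, hspace]
  · rintro ⟨s, v⟩
    simp [fderiv_apply_eq hO.isOpen hG hmem, hspace]

/-- A smooth family `G_t` of maps with `G_0 = id` on `U` is, for `(t, y)` in a neighbourhood of
`{0} × U`, injective in `y` with invertible derivative. -/
theorem exists_zeroNhd_injOn {G : ℝ × E → E} {U : Set E} {O : Set (ℝ × E)} (hU : IsOpen U)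
    (hO : IsZeroNhd U O) (hG : ContDiffOn ℝ ∞ G O) (h0 : ∀ y ∈ U, G (0, y) = y) :
    ∃ V ⊆ O, IsZeroNhd U V ∧ InjOn (fun q => (q.1, G q)) V ∧
      ∀ q ∈ V, fderiv ℝ (fun q => (q.1, G q)) q ∈
        range ((↑) : ((ℝ × E) ≃L[ℝ] (ℝ × E)) → (ℝ × E) →L[ℝ] (ℝ × E)) := by
  set Φ : ℝ × E → ℝ × E := fun q => (q.1, G q) with hΦdef
  have hΦ : ContDiffOn ℝ ∞ Φ O := contDiffOn_fst.prodMk hG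
  have hΦ' := hΦ.fderiv_of_isOpen hO.isOpen (m := ∞) (by simp)
  have key : ∀ x ∈ U, ∃ r > 0, ∃ ε > 0, ε ≤ r ∧ InjOn Φ (Metric.ball (0, x) (3 * r)) ∧
      ∀ q ∈ Metric.ball ((0 : ℝ), x) ε, q ∈ O ∧ dist (G q) q.2 < r / 2 ∧ fderiv ℝ Φ q ∈
        range ((↑) : ((ℝ × E) ≃L[ℝ] (ℝ × E)) → (ℝ × E) →L[ℝ] (ℝ × E)) := by
    intro x hx
    have hmem := hO.isOpen.mem_nhds (hO.zero_mem x hx)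
    have hinv := fderiv_prodMk_fst_mem_range hU hO hG h0 hx
    have hev := (hΦ'.continuousOn.continuousAt hmem).eventually_mem
      (ContinuousLinearEquiv.isOpen.mem_nhds hinv)
    obtain ⟨e, he⟩ := hinv
    have hs := (hΦ.contDiffAt hmem).hasStrictFDerivAt'
      (f' := (e : (ℝ × E) →L[ℝ] (ℝ × E)))
      (he ▸ hasFDerivAt_of_contDiffOn hO.isOpen hΦ (hO.zero_mem x hx)) (by simp)
    obtain ⟨R, hR, hinj⟩ := Metric.eventually_nhds_iff_ball.1 hs.eventually_left_inverse
    have hdist : ∀ᶠ q in 𝓝 ((0 : ℝ), x), dist (G q) q.2 < R / 3 / 2 := by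
      have hc : ContinuousAt (fun q : ℝ × E => dist (G q) q.2) (0, x) :=
        (hG.continuousOn.continuousAt hmem).dist continuous_snd.continuousAt
      refine hc.eventually_lt continuousAt_const ?_
      simp only [h0 x hx, dist_self]
      positivity
    -- with `r = R / 3`, the points of the small ball are displaced by less than `r / 2`
    obtain ⟨ε, hε, hball⟩ := Metric.eventually_nhds_iff_ball.1
      ((Filter.eventually_mem_set.2 hmem).and (hdist.and hev))
    refine ⟨R / 3, by positivity, min ε (R / 3), by positivity, min_le_right _ _, ?_,
      fun q hq => hball q (Metric.ball_subset_ball (min_le_left _ _) hq)⟩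
    have h3 : 3 * (R / 3) = R := by ring
    rw [h3]
    intro a ha b hb hab
    rw [← hinj a ha, ← hinj b hb, hab]
  choose! r hr ε hε hεr hinj hball using key
  refine ⟨⋃ x ∈ U, Metric.ball ((0 : ℝ), x) (ε x), ?_, ⟨?_, ?_⟩, ?_, ?_⟩
  · exact iUnion₂_subset fun x hx q hq => (hball x hx q hq).1
  · exact isOpen_biUnion fun x _ => Metric.isOpen_ball
  · exact fun x hx => mem_biUnion hx (Metric.mem_ball_self (hε x hx))
  · -- two points of the union with the same image lie in the larger of the two injectivity balls
    have aux : ∀ x ∈ U, ∀ x' ∈ U, r x' ≤ r x → ∀ q ∈ Metric.ball ((0 : ℝ), x) (ε x),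
        ∀ q' ∈ Metric.ball ((0 : ℝ), x') (ε x'), Φ q = Φ q' → q = q' := by
      intro x hx x' hx' hle q hq q' hq' heq
      have h1 : q.1 = q'.1 := (Prod.ext_iff.1 heq).1
      have h2 : G q = G q' := (Prod.ext_iff.1 heq).2
      have hd := (hball x hx q hq).2.1
      have hd' := (hball x' hx' q' hq').2.1
      have hqr := hεr x hx
      have hr0 := hr x hx
      rw [h2] at hd
      have htri : dist q'.2 x ≤ dist (G q') q'.2 + (dist (G q') q.2 + dist q.2 x) := by
        refine (dist_triangle_left q'.2 x (G q')).trans ?_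
        gcongr
        exact dist_triangle _ _ _
      rw [Metric.mem_ball, Prod.dist_eq, max_lt_iff] at hq
      refine hinj x hx ?_ ?_ heq
      · rw [Metric.mem_ball, Prod.dist_eq, max_lt_iff]
        constructor <;> dsimp only at * <;> linarith
      · rw [Metric.mem_ball, Prod.dist_eq, max_lt_iff]
        constructor
        · rw [← h1]; dsimp only at *; linarith
        · dsimp only at *; linarith
    intro q hq q' hq' heq
    obtain ⟨x, hx, hqx⟩ := mem_iUnion₂.1 hq
    obtain ⟨x', hx', hqx'⟩ := mem_iUnion₂.1 hq'
    rcases le_total (r x') (r x) with hle | hle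
    · exact aux x hx x' hx' hle q hqx q' hqx' heq
    · exact (aux x' hx' x hx hle q' hqx' q hqx heq.symm).symm
  · intro q hq
    obtain ⟨x, hx, hqx⟩ := mem_iUnion₂.1 hq
    exact (hball x hx q hqx).2.2

/-- For every `t`, the maps `y ↦ G(t, y)` on the slice of `V` and `x ↦ Y(t, x)` on the slice of `D`
are mutually inverse, and they depend smoothly on `t`. -/
structure IsFamilyInverse (G : ℝ × E → E) (V D : Set (ℝ × E)) (Y : ℝ × E → E) : Prop where
  isOpen_left : IsOpen V
  isOpen_right : IsOpen D
  smooth_left : ContDiffOn ℝ ∞ G V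
  smooth_right : ContDiffOn ℝ ∞ Y D
  map_left : ∀ q ∈ V, (q.1, G q) ∈ D
  map_right : ∀ q ∈ D, (q.1, Y q) ∈ V
  left_inv : ∀ q ∈ V, Y (q.1, G q) = q.2
  right_inv : ∀ q ∈ D, G (q.1, Y q) = q.2

theorem exists_isFamilyInverse {G : ℝ × E → E} {V : Set (ℝ × E)} (hV : IsOpen V)
    (hG : ContDiffOn ℝ ∞ G V) (hinj : InjOn (fun q => (q.1, G q)) V)
    (hinv : ∀ q ∈ V, fderiv ℝ (fun q => (q.1, G q)) q ∈
      range ((↑) : ((ℝ × E) ≃L[ℝ] (ℝ × E)) → (ℝ × E) →L[ℝ] (ℝ × E))) :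
    ∃ D Y, IsFamilyInverse G V D Y := by
  obtain ⟨hopen, Ψ, hΨ, hΨinv⟩ := exists_contDiffOn_inverse hV (contDiffOn_fst.prodMk hG) hinj hinv
  have h1 : ∀ q ∈ V, Ψ (q.1, G q) = q := hΨinv
  refine ⟨_, fun q => (Ψ q).2, hV, hopen, hG, contDiff_snd.comp_contDiffOn hΨ,
    fun q hq => mem_image_of_mem _ hq, ?_, fun q hq => by rw [h1 q hq], ?_⟩
  · rintro _ ⟨q, hq, rfl⟩
    dsimp only
    rwa [h1 q hq]
  · rintro _ ⟨q, hq, rfl⟩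
    dsimp only
    rw [h1 q hq]

theorem IsFamilyInverse.isZeroNhd {G : ℝ × E → E} {V D : Set (ℝ × E)} {Y : ℝ × E → E}
    (h : IsFamilyInverse G V D Y) {U : Set E} (hV : IsZeroNhd U V) (h0 : ∀ y ∈ U, G (0, y) = y) :
    IsZeroNhd U D :=
  ⟨h.isOpen_right, fun z hz => by simpa [h0 z hz] using h.map_left _ (hV.zero_mem z hz)⟩

theorem IsFamilyInverse.zero_time {G : ℝ × E → E} {V D : Set (ℝ × E)} {Y : ℝ × E → E}
    (h : IsFamilyInverse G V D Y) {U : Set E} (hV : IsZeroNhd U V) (h0 : ∀ y ∈ U, G (0, y) = y)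
    {z : E} (hz : z ∈ U) : Y (0, z) = z := by
  simpa [h0 z hz] using h.left_inv _ (hV.zero_mem z hz)

/-- The points that stay in an open set when time is shrunk to `0` form an open set. -/
theorem isOpen_setOf_forall_smul_mem {D : Set (ℝ × E)} (hD : IsOpen D) :
    IsOpen {q : ℝ × E | ∀ s ∈ Icc (0 : ℝ) 1, (s * q.1, q.2) ∈ D} := by
  rw [isOpen_iff_mem_nhds]
  intro q hq
  refine isCompact_Icc.eventually_forall_of_forall_eventually
    (P := fun (q : ℝ × E) (s : ℝ) => (s * q.1, q.2) ∈ D) fun s hs => ?_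
  have hc : Continuous fun z : (ℝ × E) × ℝ => (z.2 * z.1.1, z.1.2) := by fun_prop
  exact hc.continuousAt.eventually_mem (hD.mem_nhds (hq s hs))

end Inverse

/-! ### Brackets as pairings of covectors -/

section Brackets

variable {n : ℕ}

/-- The vector `(-c_p, c_x)` attached to the covector `c = (c_x, c_p)` by the canonical bracket. -/
noncomputable def sharp (c : Rn n × Rn n →L[ℝ] ℝ) : Rn n × Rn n :=
  (-∑ i, c (0, EuclideanSpace.single i 1) • EuclideanSpace.single i (1 : ℝ),
    ∑ i, c (EuclideanSpace.single i 1, 0) • EuclideanSpace.single i (1 : ℝ))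

/-- A Poisson tensor as a linear map from covectors to vectors. -/
noncomputable def tensorMap (π : Rn n → Matrix (Fin n) (Fin n) ℝ) (x : Rn n) :
    (Rn n →L[ℝ] ℝ) →L[ℝ] Rn n :=
  ∑ i, ∑ j, π x i j • (ContinuousLinearMap.apply ℝ ℝ
    (EuclideanSpace.single j (1 : ℝ) : Rn n)).smulRight (EuclideanSpace.single i (1 : ℝ) : Rn n)

theorem apply_tensorMap (π : Rn n → Matrix (Fin n) (Fin n) ℝ) (x : Rn n) (ξ η : Rn n →L[ℝ] ℝ) :
    ξ (tensorMap π x η) = ∑ i, ∑ j, π x i j * ξ (EuclideanSpace.single i 1) *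
      η (EuclideanSpace.single j 1) := by
  simp [tensorMap, map_sum, mul_comm, mul_left_comm]

theorem bracket_eq (π : Rn n → Matrix (Fin n) (Fin n) ℝ) (F G : Rn n → ℝ) (x : Rn n) :
    bracket π F G x = fderiv ℝ F x (tensorMap π x (fderiv ℝ G x)) := by
  rw [apply_tensorMap]; rfl

theorem apply_tensorMap_skew {U : Set (Rn n)} {π : Rn n → Matrix (Fin n) (Fin n) ℝ}
    (hπ : IsPoissonStructure U π) {x : Rn n} (hx : x ∈ U) (ξ η : Rn n →L[ℝ] ℝ) :
    ξ (tensorMap π x η) = -η (tensorMap π x ξ) := by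
  rw [apply_tensorMap, apply_tensorMap, Finset.sum_comm, ← Finset.sum_neg_distrib]
  refine Finset.sum_congr rfl fun j _ => ?_
  rw [← Finset.sum_neg_distrib]
  refine Finset.sum_congr rfl fun i _ => ?_
  rw [hπ.skew x hx j i]
  ring

theorem hamVF_eq (π : Rn n → Matrix (Fin n) (Fin n) ℝ) (H : Rn n → ℝ) (x : Rn n) :
    hamVF π H x = tensorMap π x (fderiv ℝ H x) := by
  have hg : ∀ j, (gradient H x).ofLp j = fderiv ℝ H x (EuclideanSpace.single j 1) := by
    intro j
    have := InnerProductSpace.toDual_symm_apply (𝕜 := ℝ) (x := EuclideanSpace.single j (1 : ℝ))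
      (y := fderiv ℝ H x)
    rw [← this, EuclideanSpace.inner_single_right]
    simp [gradient]
  ext i
  simp only [hamVF, Matrix.mulVec, dotProduct, hg]
  have := apply_tensorMap π x (EuclideanSpace.proj i) (fderiv ℝ H x)
  change _ = (EuclideanSpace.proj i : Rn n →L[ℝ] ℝ) (tensorMap π x (fderiv ℝ H x))
  rw [this]
  simp [ite_mul]

theorem contDiffOn_tensorMap {U : Set (Rn n)} {π : Rn n → Matrix (Fin n) (Fin n) ℝ}
    (hπ : IsPoissonStructure U π) : ContDiffOn ℝ ∞ (tensorMap π) U := by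
  unfold tensorMap
  exact ContDiffOn.sum fun i _ => ContDiffOn.sum fun j _ =>
    ((ContinuousLinearMap.id ℝ ℝ).smulRight _).contDiff.comp_contDiffOn (hπ.smooth i j)

theorem sum_smul_single_apply (ξ : Rn n →L[ℝ] ℝ) (a : Fin n → ℝ) :
    ξ (∑ i, a i • EuclideanSpace.single i (1 : ℝ)) = ∑ i, a i * ξ (EuclideanSpace.single i 1) := by
  simp [map_sum]

theorem apply_sharp (f g : Rn n × Rn n →L[ℝ] ℝ) :
    g (sharp f) = ∑ i : Fin n,
      (f (EuclideanSpace.single i 1, 0) * g (0, EuclideanSpace.single i 1)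
        - f (0, EuclideanSpace.single i 1) * g (EuclideanSpace.single i 1, 0)) := by
  have h1 := sum_smul_single_apply (g.comp (ContinuousLinearMap.inl ℝ (Rn n) (Rn n)))
    fun i => f (0, EuclideanSpace.single i 1)
  have h2 := sum_smul_single_apply (g.comp (ContinuousLinearMap.inr ℝ (Rn n) (Rn n)))
    fun i => f (EuclideanSpace.single i 1, 0)
  simp only [ContinuousLinearMap.comp_apply, ContinuousLinearMap.inl_apply,
    ContinuousLinearMap.inr_apply] at h1 h2
  have h3 : sharp f = -((∑ i, f (0, EuclideanSpace.single i 1) • EuclideanSpace.single i (1 : ℝ)),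
      (0 : Rn n)) + ((0 : Rn n),
      ∑ i, f (EuclideanSpace.single i 1, 0) • EuclideanSpace.single i (1 : ℝ)) := by
    simp [sharp]
  rw [h3, map_add, map_neg, h1, h2, Finset.sum_sub_distrib]
  ring

theorem canBracket_eq (F G : Rn n × Rn n → ℝ) (w : Rn n × Rn n) :
    canBracket F G w = fderiv ℝ G w (sharp (fderiv ℝ F w)) := by
  rw [apply_sharp]; rfl

theorem apply_sharp_antisymm (f g : Rn n × Rn n →L[ℝ] ℝ) : g (sharp f) = -f (sharp g) := by
  rw [apply_sharp, apply_sharp, ← Finset.sum_neg_distrib]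
  exact Finset.sum_congr rfl fun i _ => by ring

theorem sharp_sub (f g : Rn n × Rn n →L[ℝ] ℝ) : sharp (f - g) = sharp f - sharp g := by
  simp only [sharp, sub_apply, sub_smul, Finset.sum_sub_distrib,
    Prod.mk_sub_mk]
  congr 1
  abel

/-- The tangent space `{(v, Bv)}` to the graph of a closed one-form is Lagrangian: a covector `c`
that restricts to `v ↦ ⟪l, v⟫` on it satisfies `c^♯ = (u, Bu + l)` for some `u`. -/
theorem sharp_snd_of_restrict {B : Rn n →L[ℝ] Rn n}
    (hB : ∀ u v, inner ℝ (B u) v = inner ℝ (B v) u) {c : Rn n × Rn n →L[ℝ] ℝ} {l : Rn n}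
    (hc : ∀ v, c (v, B v) = inner ℝ l v) : (sharp c).2 = B (sharp c).1 + l := by
  have hcomp : ∀ (g : Rn n →L[ℝ] ℝ) (v : Rn n),
      inner ℝ (∑ i, g (EuclideanSpace.single i 1) • EuclideanSpace.single i (1 : ℝ)) v = g v := by
    intro g v
    have hv : v = ∑ i, v i • EuclideanSpace.single i (1 : ℝ) := by
      ext j; simp [Pi.single_apply]
    conv_rhs => rw [hv, sum_smul_single_apply]
    simp [sum_inner, inner_smul_left, EuclideanSpace.inner_single_left, mul_comm]
  have hx := hcomp (c.comp (ContinuousLinearMap.inl ℝ (Rn n) (Rn n)))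
  have hp := hcomp (c.comp (ContinuousLinearMap.inr ℝ (Rn n) (Rn n)))
  simp only [ContinuousLinearMap.comp_apply, ContinuousLinearMap.inl_apply,
    ContinuousLinearMap.inr_apply] at hx hp
  refine ext_inner_right ℝ fun v => ?_
  have h1 : inner ℝ (sharp c).2 v = c (v, 0) := hx v
  have h2 : inner ℝ (sharp c).1 (B v) = -c (0, B v) := by
    rw [← hp (B v), ← inner_neg_left]; rfl
  have h3 := hc v
  have h4 : (v, B v) = (v, (0 : Rn n)) + ((0 : Rn n), B v) := by simp
  rw [h4, map_add] at h3
  rw [inner_add_left, h1, hB, real_inner_comm, h2]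
  linarith

end Brackets

/-! ### Symplectic geometry of a bi-realisation at a point -/

section Pointwise

variable {n : ℕ} {U : Set (Rn n)} {π : Rn n → Matrix (Fin n) (Fin n) ℝ}
  {W : Set (Rn n × Rn n)} {α β : Rn n × Rn n → Rn n}

theorem eq_of_forall_covector {x y : Rn n} (h : ∀ ξ : Rn n →L[ℝ] ℝ, ξ x = ξ y) : x = y := by
  ext i
  exact h (EuclideanSpace.proj i)

theorem IsBiRealisation.source_mem (hW : IsBiRealisation U π W α β) {w : Rn n × Rn n}
    (hw : w ∈ W) : α w ∈ U := hW.image_source ▸ mem_image_of_mem α hw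

theorem IsBiRealisation.target_mem (hW : IsBiRealisation U π W α β) {w : Rn n × Rn n}
    (hw : w ∈ W) : β w ∈ U := hW.image_target ▸ mem_image_of_mem β hw

theorem fderiv_covector_comp {f : Rn n × Rn n → Rn n} (hW : IsOpen W)
    (hf : ContDiffOn ℝ ∞ f W) {w : Rn n × Rn n} (hw : w ∈ W) (ξ : Rn n →L[ℝ] ℝ) :
    fderiv ℝ (ξ ∘ f) w = ξ.comp (fderiv ℝ f w) :=
  (ξ.hasFDerivAt.comp w (hasFDerivAt_of_contDiffOn hW hf hw)).fderiv

theorem IsBiRealisation.source_pairing (hW : IsBiRealisation U π W α β) {w : Rn n × Rn n}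
    (hw : w ∈ W) (ξ η : Rn n →L[ℝ] ℝ) :
    η (fderiv ℝ α w (sharp (ξ.comp (fderiv ℝ α w)))) = ξ (tensorMap π (α w) η) := by
  have h := hW.poisson ξ η ξ.contDiff.contDiffOn η.contDiff.contDiffOn w hw
  rw [canBracket_eq, bracket_eq, fderiv_covector_comp hW.isOpen hW.smooth_source hw,
    fderiv_covector_comp hW.isOpen hW.smooth_source hw, ξ.fderiv, η.fderiv] at h
  exact h

theorem IsBiRealisation.target_pairing (hW : IsBiRealisation U π W α β) {w : Rn n × Rn n}
    (hw : w ∈ W) (ξ η : Rn n →L[ℝ] ℝ) :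
    η (fderiv ℝ β w (sharp (ξ.comp (fderiv ℝ β w)))) = -ξ (tensorMap π (β w) η) := by
  have h := hW.antiPoisson ξ η ξ.contDiff.contDiffOn η.contDiff.contDiffOn w hw
  rw [canBracket_eq, bracket_eq, fderiv_covector_comp hW.isOpen hW.smooth_target hw,
    fderiv_covector_comp hW.isOpen hW.smooth_target hw, ξ.fderiv, η.fderiv] at h
  exact h

theorem IsBiRealisation.mixed_pairing (hW : IsBiRealisation U π W α β) {w : Rn n × Rn n}
    (hw : w ∈ W) (ξ η : Rn n →L[ℝ] ℝ) :
    η (fderiv ℝ β w (sharp (ξ.comp (fderiv ℝ α w)))) = 0 := by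
  have h := hW.orthogonal ξ η ξ.contDiff.contDiffOn η.contDiff.contDiffOn w hw
  rw [canBracket_eq, fderiv_covector_comp hW.isOpen hW.smooth_source hw,
    fderiv_covector_comp hW.isOpen hW.smooth_target hw] at h
  exact h

theorem IsBiRealisation.mixed_pairing' (hW : IsBiRealisation U π W α β) {w : Rn n × Rn n}
    (hw : w ∈ W) (ξ η : Rn n →L[ℝ] ℝ) :
    ξ (fderiv ℝ α w (sharp (η.comp (fderiv ℝ β w)))) = 0 := by
  have h := apply_sharp_antisymm (η.comp (fderiv ℝ β w)) (ξ.comp (fderiv ℝ α w))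
  simp only [ContinuousLinearMap.comp_apply, hW.mixed_pairing hw] at h
  simpa using h

/-- A Lagrangian graph transverse to the fibres of `α` induces a Poisson map: if the linear map
`M` sends `dα` to `dβ` along the graph, it carries `π` at the source to `π` at the target. For a
covector `ξ`, the covector `ξ ∘ M ∘ dα - ξ ∘ dβ` annihilates the graph, and two covectors which
annihilate a Lagrangian subspace have vanishing bracket. -/
theorem IsBiRealisation.apply_tensorMap_of_graph (hW : IsBiRealisation U π W α β)
    {w : Rn n × Rn n} (hw : w ∈ W) {B M : Rn n →L[ℝ] Rn n}
    (hB : ∀ u v, inner ℝ (B u) v = inner ℝ (B v) u)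
    (hM : ∀ v, M (fderiv ℝ α w (v, B v)) = fderiv ℝ β w (v, B v)) (ξ η : Rn n →L[ℝ] ℝ) :
    ξ (M (tensorMap π (α w) (η.comp M))) = ξ (tensorMap π (β w) η) := by
  let f : (Rn n →L[ℝ] ℝ) → (Rn n × Rn n →L[ℝ] ℝ) := fun ξ =>
    (ξ.comp M).comp (fderiv ℝ α w) - ξ.comp (fderiv ℝ β w)
  have hf : ∀ ξ v, f ξ (v, B v) = 0 := fun ξ v => by simp [f, hM]
  have hs := sharp_snd_of_restrict hB (c := f ξ) (l := 0) fun v => by rw [hf]; simp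
  have hz : f η (sharp (f ξ)) = 0 := by
    have : sharp (f ξ) = ((sharp (f ξ)).1, B (sharp (f ξ)).1) := by
      rw [add_zero] at hs
      exact Prod.ext rfl hs
    rw [this, hf]
  have hexp : f η (sharp (f ξ)) = (ξ.comp M) (tensorMap π (α w) (η.comp M))
      - ξ (tensorMap π (β w) η) := by
    have h1 := hW.source_pairing hw (ξ.comp M) (η.comp M)
    have h2 := hW.target_pairing hw ξ η
    have h3 := hW.mixed_pairing hw (ξ.comp M) η
    have h4 := hW.mixed_pairing' hw (η.comp M) ξ
    rw [sharp_sub]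
    simp only [f, map_sub, sub_apply, ContinuousLinearMap.comp_apply] at h1 h2 h3 h4 ⊢
    rw [h1, h2, h3, h4]
    ring
  rw [hexp] at hz
  exact sub_eq_zero.1 hz

/-- Let `(u, Bu + l)` be the velocity of a point which stays on a moving Lagrangian graph and in a
fibre of `α`; here `l` is the velocity of the graph. Its image under `dβ` is the Hamiltonian vector
of the covector `η` for which `l` is the restriction of `η ∘ dβ` to the graph. -/
theorem IsBiRealisation.target_velocity (hπ : IsPoissonStructure U π)
    (hW : IsBiRealisation U π W α β) {w : Rn n × Rn n} (hw : w ∈ W) {B : Rn n →L[ℝ] Rn n}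
    (hB : ∀ u v, inner ℝ (B u) v = inner ℝ (B v) u)
    (hinj : ∀ v, fderiv ℝ α w (v, B v) = 0 → v = 0) {u l : Rn n} {η : Rn n →L[ℝ] ℝ}
    (hu : fderiv ℝ α w (u, B u + l) = 0) (hη : ∀ v, η (fderiv ℝ β w (v, B v)) = inner ℝ l v) :
    fderiv ℝ β w (u, B u + l) = tensorMap π (β w) η := by
  set s := sharp (η.comp (fderiv ℝ β w)) with hs_def
  have hs : s.2 = B s.1 + l := sharp_snd_of_restrict hB hη
  have has : fderiv ℝ α w s = 0 := eq_of_forall_covector fun ξ => by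
    rw [hW.mixed_pairing' hw, map_zero]
  -- the difference with the canonical Hamiltonian vector `s` of `η ∘ dβ` is tangent to the graph
  have hus : (u, B u + l) - s = (u - s.1, B (u - s.1)) := by
    refine Prod.ext rfl ?_
    change B u + l - s.2 = B (u - s.1)
    rw [hs, map_sub]
    abel
  have h0 : u - s.1 = 0 := hinj _ (by rw [← hus, map_sub, hu, has, sub_zero])
  have hus' : (u, B u + l) = s := by
    rw [← sub_eq_zero, hus, h0, map_zero]
    rfl
  refine eq_of_forall_covector fun ξ => ?_
  rw [hus', hW.target_pairing hw, ← apply_tensorMap_skew hπ (hW.target_mem hw)]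

end Pointwise

/-! ### The Hamilton-Jacobi transform -/

section HamiltonJacobi

section PowerSum

set_option linter.unusedSectionVars false

variable {E F : Type} [NormedAddCommGroup E] [NormedSpace ℝ E]
  [NormedAddCommGroup F] [NormedSpace ℝ F]

/-- The polynomial `∑_{j < N} (tʲ / j!) c_j(z)` in `t` with coefficients depending on `z`. -/
noncomputable def powerSum (c : ℕ → E → F) (N : ℕ) (q : ℝ × E) : F :=
  ∑ j ∈ Finset.range N, (q.1 ^ j / (j.factorial : ℝ)) • c j q.2

theorem contDiffOn_powerSum {c : ℕ → E → F} {N : ℕ} {U : Set E}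
    (hc : ∀ j < N, ContDiffOn ℝ ∞ (c j) U) : ContDiffOn ℝ ∞ (powerSum c N) (univ ×ˢ U) := by
  refine ContDiffOn.sum fun j hj => ContDiffOn.smul (by fun_prop) ?_
  exact (hc j (Finset.mem_range.1 hj)).comp contDiffOn_snd fun q hq => hq.2

theorem timeDeriv_powerSum (c : ℕ → E → F) (N : ℕ) (q : ℝ × E) :
    timeDeriv (powerSum c (N + 1)) q = powerSum (fun j => c (j + 1)) N q := by
  have h : ∀ j, HasDerivAt (fun t : ℝ => (t ^ (j + 1) / ((j + 1).factorial : ℝ)) • c (j + 1) q.2)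
      ((q.1 ^ j / (j.factorial : ℝ)) • c (j + 1) q.2) q.1 := by
    intro j
    refine HasDerivAt.smul_const ?_ _
    refine ((hasDerivAt_pow (j + 1) q.1).div_const _).congr_deriv ?_
    have : (j.factorial : ℝ) ≠ 0 := by positivity
    rw [Nat.factorial_succ]
    push_cast
    field_simp
  have hs := (HasDerivAt.fun_sum fun j (_ : j ∈ Finset.range N) => h j).add_const
    (((1 : ℝ) / ((Nat.factorial 0 : ℕ) : ℝ)) • c 0 q.2)
  have : (fun t => powerSum c (N + 1) (t, q.2)) = fun t => (∑ j ∈ Finset.range N,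
      (t ^ (j + 1) / ((j + 1).factorial : ℝ)) • c (j + 1) q.2) +
      ((1 : ℝ) / ((Nat.factorial 0 : ℕ) : ℝ)) • c 0 q.2 := by
    funext t
    simp [powerSum, Finset.sum_range_succ']
  unfold timeDeriv
  rw [this]
  exact hs.deriv

theorem powerSum_zero_time {c : ℕ → E → F} {N : ℕ} (hN : 0 < N) (z : E) :
    powerSum c N (0, z) = c 0 z := by
  obtain ⟨M, rfl⟩ := Nat.exists_eq_succ_of_ne_zero hN.ne'
  simp [powerSum, Finset.sum_range_succ']

theorem iteratedDeriv_powerSum (c : ℕ → E → F) {N i : ℕ} (hi : i < N) (z : E) :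
    iteratedDeriv i (fun t => powerSum c N (t, z)) 0 = c i z := by
  induction i generalizing c N with
  | zero => simpa using powerSum_zero_time hi z
  | succ i ih =>
    obtain ⟨M, rfl⟩ := Nat.exists_eq_succ_of_ne_zero (by omega : N ≠ 0)
    rw [iteratedDeriv_succ']
    have : deriv (fun t => powerSum c (M + 1) (t, z)) =
        fun t => powerSum (fun j => c (j + 1)) M (t, z) := by
      funext t
      exact timeDeriv_powerSum c M (t, z)
    rw [this]
    exact ih (fun j => c (j + 1)) (by omega)

end PowerSum

variable {n : ℕ} {U : Set (Rn n)} {π : Rn n → Matrix (Fin n) (Fin n) ℝ}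
  {W : Set (Rn n × Rn n)} {α β : Rn n × Rn n → Rn n} {H : Rn n → ℝ}

theorem contDiffOn_gradient {f : Rn n → ℝ} (hU : IsOpen U) (hf : ContDiffOn ℝ ∞ f U) :
    ContDiffOn ℝ ∞ (gradient f) U :=
  ((InnerProductSpace.toDual ℝ (Rn n)).symm.contDiff.comp_contDiffOn
    (hf.fderiv_of_isOpen hU (m := ∞) (by simp)))

/-- The covector `∑_{j < N} (tʲ / j!) ∇S_j` (where `S_0 = 0`). -/
noncomputable def momentum (α : Rn n × Rn n → Rn n) (H : Rn n → ℝ) (N : ℕ) :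
    ℝ × Rn n → Rn n :=
  powerSum (fun j => gradient (hjTerm α H j)) N

theorem gradient_hjTerm_zero (z : Rn n) : gradient (hjTerm α H 0) z = 0 := by
  have : hjTerm α H 0 = fun _ => 0 := by rw [hjTerm]; rfl
  rw [this]
  simp [gradient]

theorem schemeMomentum_eq (k : ℕ) (h : ℝ) (y : Rn n) :
    schemeMomentum α H k h y = momentum α H (k + 1) (h, y) := by
  unfold schemeMomentum momentum powerSum
  rw [Finset.sum_range_succ']
  dsimp only
  rw [gradient_hjTerm_zero, smul_zero, add_zero, Finset.range_eq_Ico,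
    Finset.sum_Ico_add' (fun j => (h ^ j / (j.factorial : ℝ)) •
      gradient (hjTerm α H j) y) 0 k 1]
  rfl

theorem momentum_zero_time (N : ℕ) (z : Rn n) : momentum α H N (0, z) = 0 := by
  rcases Nat.eq_zero_or_pos N with rfl | hN
  · simp [momentum, powerSum]
  · rw [momentum, powerSum_zero_time hN, gradient_hjTerm_zero]

/-- The defining recursion of the `S_i`, for all `i ≥ 0`: the momentum truncated below degree `1`
vanishes, so that the case `S_1 = H` is included. -/
theorem hjTerm_succ (hW : IsBiRealisation U π W α β) {i : ℕ}
    (hS : ∀ j ≤ i, DifferentiableOn ℝ (hjTerm α H j) U) (hU : IsOpen U) {m : Rn n} (hm : m ∈ U) :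
    hjTerm α H (i + 1) m =
      iteratedDeriv i (fun t : ℝ => H (α (m, momentum α H (i + 1) (t, m)))) 0 := by
  cases i with
  | zero =>
    have : ∀ t, momentum α H 1 (t, m) = 0 := fun t => by
      simp [momentum, powerSum, gradient_hjTerm_zero]
    simp [hjTerm, this, hW.source_zero m hm]
  | succ i =>
    have hg : ∀ t : ℝ, gradient (fun z => ∑ j : Fin (i + 1),
        t ^ ((j : ℕ) + 1) / (((j : ℕ) + 1).factorial : ℝ) * hjTerm α H ((j : ℕ) + 1) z) m =
        momentum α H (i + 2) (t, m) := by
      intro t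
      have hd : ∀ j : Fin (i + 1), HasGradientAt (fun z =>
          t ^ ((j : ℕ) + 1) / (((j : ℕ) + 1).factorial : ℝ) * hjTerm α H ((j : ℕ) + 1) z)
          ((t ^ ((j : ℕ) + 1) / (((j : ℕ) + 1).factorial : ℝ)) •
            gradient (hjTerm α H ((j : ℕ) + 1)) m) m := by
        intro j
        have h1 := ((hS (j + 1) (by omega)).differentiableAt (hU.mem_nhds hm)).hasFDerivAt
        rw [hasGradientAt_iff_hasFDerivAt]
        refine (h1.const_mul _).congr_fderiv ?_
        simp [gradient]
      have hs : HasGradientAt (fun z => ∑ j : Fin (i + 1),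
          t ^ ((j : ℕ) + 1) / (((j : ℕ) + 1).factorial : ℝ) * hjTerm α H ((j : ℕ) + 1) z)
          (∑ j : Fin (i + 1), (t ^ ((j : ℕ) + 1) / (((j : ℕ) + 1).factorial : ℝ)) •
            gradient (hjTerm α H ((j : ℕ) + 1)) m) m := by
        rw [hasGradientAt_iff_hasFDerivAt]
        refine (HasFDerivAt.fun_sum fun j _ => (hd j).hasFDerivAt).congr_fderiv ?_
        simp [map_sum]
      rw [hs.gradient, momentum, powerSum, Finset.sum_range_succ', gradient_hjTerm_zero,
        smul_zero, add_zero, Fin.sum_univ_eq_sum_range (fun j => (t ^ (j + 1) /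
          ((j + 1).factorial : ℝ)) • gradient (hjTerm α H (j + 1)) m)]
    rw [hjTerm]
    simp only [hg]

/-- The points `(t, y)` at which the graph of the momentum lies in `W`. -/
def momentumDomain (U : Set (Rn n)) (W : Set (Rn n × Rn n)) (α : Rn n × Rn n → Rn n)
    (H : Rn n → ℝ) (N : ℕ) : Set (ℝ × Rn n) :=
  {q | q.2 ∈ U ∧ (q.2, momentum α H N q) ∈ W}

theorem contDiffOn_momentum (hU : IsOpen U) {N : ℕ}
    (hS : ∀ j < N, ContDiffOn ℝ ∞ (hjTerm α H j) U) :
    ContDiffOn ℝ ∞ (momentum α H N) (univ ×ˢ U) :=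
  contDiffOn_powerSum fun j hj => contDiffOn_gradient hU (hS j hj)

theorem momentumDomain_subset (N : ℕ) : momentumDomain U W α H N ⊆ univ ×ˢ U :=
  fun _ hq => ⟨mem_univ _, hq.1⟩

theorem isZeroNhd_momentumDomain (hW : IsBiRealisation U π W α β) (hU : IsOpen U) {N : ℕ}
    (hS : ∀ j < N, ContDiffOn ℝ ∞ (hjTerm α H j) U) :
    IsZeroNhd U (momentumDomain U W α H N) where
  isOpen := by
    have h : ContinuousOn (fun q : ℝ × Rn n => (q.2, momentum α H N q)) (univ ×ˢ U) :=
      continuousOn_snd.prodMk (contDiffOn_momentum hU hS).continuousOn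
    have := h.isOpen_inter_preimage (isOpen_univ.prod hU) hW.isOpen
    convert this using 1
    ext q
    simp [momentumDomain]
  zero_mem z hz := ⟨hz, by rw [momentum_zero_time]; exact hW.zero_mem z hz⟩

theorem contDiffOn_comp_momentum {F : Type} [NormedAddCommGroup F] [NormedSpace ℝ F]
    {f : Rn n × Rn n → F} (hf : ContDiffOn ℝ ∞ f W) (hU : IsOpen U) {N : ℕ}
    (hS : ∀ j < N, ContDiffOn ℝ ∞ (hjTerm α H j) U) :
    ContDiffOn ℝ ∞ (fun q => f (q.2, momentum α H N q)) (momentumDomain U W α H N) :=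
  hf.comp (contDiffOn_snd.prodMk ((contDiffOn_momentum hU hS).mono (momentumDomain_subset N)))
    fun _ hq => hq.2

theorem contDiffOn_hamiltonian_source (hW : IsBiRealisation U π W α β)
    (hH : ContDiffOn ℝ ∞ H U) : ContDiffOn ℝ ∞ (fun w => H (α w)) W :=
  hH.comp hW.smooth_source fun _ hw => hW.source_mem hw

theorem contDiffOn_hjTerm (hW : IsBiRealisation U π W α β) (hU : IsOpen U)
    (hH : ContDiffOn ℝ ∞ H U) (i : ℕ) : ContDiffOn ℝ ∞ (hjTerm α H i) U := by
  induction i using Nat.strong_induction_on with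
  | _ i ih =>
    cases i with
    | zero =>
      have : hjTerm α H 0 = fun _ => 0 := by rw [hjTerm]; rfl
      rw [this]
      exact contDiffOn_const
    | succ i =>
      have hO := isZeroNhd_momentumDomain hW hU (N := i + 1) ih
      have h := contDiffOn_iteratedDeriv_time hO.isOpen
        (contDiffOn_comp_momentum (contDiffOn_hamiltonian_source hW hH) hU ih) i
      refine (h.comp (contDiffOn_const.prodMk contDiffOn_id) fun z hz =>
        hO.zero_mem z hz).congr fun z hz => ?_
      exact hjTerm_succ hW (fun j hj => (ih j (by omega)).differentiableOn (by simp)) hU hz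

/-- The truncated Hamilton-Jacobi equation: for `S = ∑_{j ≤ k} (tʲ / j!) S_j`, the functions
`∂_t S` and `H(α(y, ∇S))` have the same `k` first Taylor coefficients at `t = 0`. -/
theorem vanishesToOrder_hamiltonJacobi (hW : IsBiRealisation U π W α β) (hU : IsOpen U)
    (hH : ContDiffOn ℝ ∞ H U) (k : ℕ) :
    VanishesToOrder U k (fun q => timeDeriv (powerSum (hjTerm α H) (k + 1)) q -
      H (α (q.2, momentum α H (k + 1) q))) := by
  have hS := contDiffOn_hjTerm hW hU hH
  have hO : ∀ N, IsZeroNhd U (momentumDomain U W α H N) := fun N =>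
    isZeroNhd_momentumDomain hW hU fun j _ => hS j
  have hsub : ∀ N, momentumDomain U W α H N ⊆ univ ×ˢ U := momentumDomain_subset
  have hHα := contDiffOn_hamiltonian_source hW hH
  have hT : ContDiffOn ℝ ∞ (timeDeriv (powerSum (hjTerm α H) (k + 1))) (univ ×ˢ U) :=
    contDiffOn_timeDeriv (isOpen_univ.prod hU) (contDiffOn_powerSum fun j _ => hS j)
  have hHαP : ∀ N, ContDiffOn ℝ ∞ (fun q => H (α (q.2, momentum α H N q)))
      (momentumDomain U W α H N) :=
    fun N => contDiffOn_comp_momentum hHα hU fun j _ => hS j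
  rw [vanishesToOrder_sub_iff (hO (k + 1)) (hT.mono (hsub _)) (hHαP _)]
  intro i hi z hz
  have h1 : iteratedDeriv i (fun t => timeDeriv (powerSum (hjTerm α H) (k + 1)) (t, z)) 0 =
      hjTerm α H (i + 1) z := by
    rw [← iteratedDeriv_powerSum (hjTerm α H) (show i + 1 < k + 1 by omega) z,
      iteratedDeriv_succ']
    rfl
  rw [h1, hjTerm_succ hW (fun j _ => (hS j).differentiableOn (by simp)) hU hz]
  -- momenta truncated at `i` and at `k` agree to order `i + 1` in time
  have hO2 : IsZeroNhd U (momentumDomain U W α H (i + 1) ∩ momentumDomain U W α H (k + 1)) :=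
    ⟨(hO _).isOpen.inter (hO _).isOpen,
      fun z hz => ⟨(hO _).zero_mem z hz, (hO _).zero_mem z hz⟩⟩
  have hP : ∀ N, ContDiffOn ℝ ∞ (momentum α H N)
      (momentumDomain U W α H (i + 1) ∩ momentumDomain U W α H (k + 1)) := fun N =>
    (contDiffOn_momentum hU fun j _ => hS j).mono (inter_subset_left.trans (hsub _))
  have hmom : VanishesToOrder U (i + 1)
      (fun q => momentum α H (i + 1) q - momentum α H (k + 1) q) := by
    rw [vanishesToOrder_sub_iff hO2 (hP _) (hP _)]
    intro l hl z _
    unfold momentum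
    rw [iteratedDeriv_powerSum _ hl, iteratedDeriv_powerSum _ (show l < k + 1 by omega)]
  have hv := VanishesToOrder.comp_sub hW.isOpen hO2 hHα (hP _) (hP _)
    (fun q hq => hq.1.2) (fun q hq => hq.2.2) hmom
  exact (vanishesToOrder_sub_iff hO2 ((hHαP _).mono inter_subset_left)
    ((hHαP _).mono inter_subset_right)).1 hv i (Nat.lt_succ_self i) z hz

theorem inner_momentum (hS : ∀ j, ContDiffOn ℝ ∞ (hjTerm α H j) U) (hU : IsOpen U)
    (N : ℕ) {q : ℝ × Rn n} (hq : q.2 ∈ U) (v : Rn n) :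
    inner ℝ (momentum α H N q) v = fderiv ℝ (powerSum (hjTerm α H) N) q (0, v) := by
  have hO := isOpen_univ.prod hU (X := ℝ)
  have hs := contDiffOn_powerSum (c := hjTerm α H) (N := N) fun j _ => hS j
  rw [fderiv_apply_eq hO hs ⟨mem_univ _, hq⟩, zero_smul, zero_add]
  have hd : HasFDerivAt (fun z => powerSum (hjTerm α H) N (q.1, z))
      (∑ j ∈ Finset.range N, (q.1 ^ j / (j.factorial : ℝ)) • fderiv ℝ (hjTerm α H j) q.2) q.2 :=
    HasFDerivAt.fun_sum fun j _ => (hasFDerivAt_of_contDiffOn hU (hS j) hq).fun_const_smul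
      (q.1 ^ j / (j.factorial : ℝ))
  have : spaceDeriv (powerSum (hjTerm α H) N) q = _ := hd.fderiv
  rw [this]
  simp [momentum, powerSum, sum_inner, inner_smul_left]

/-- The derivative of the momentum: symmetric in space, and in time the gradient of `∂_t S`. -/
theorem momentum_deriv (hS : ∀ j, ContDiffOn ℝ ∞ (hjTerm α H j) U) (hU : IsOpen U)
    (N : ℕ) {q : ℝ × Rn n} (hq : q.2 ∈ U) :
    (∀ u v, inner ℝ (spaceDeriv (momentum α H N) q u) v =
      inner ℝ (spaceDeriv (momentum α H N) q v) u) ∧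
    ∀ v, inner ℝ (timeDeriv (momentum α H N) q) v =
      spaceDeriv (timeDeriv (powerSum (hjTerm α H) N)) q v := by
  have hO := isOpen_univ.prod hU (X := ℝ)
  have hqO : q ∈ (univ : Set ℝ) ×ˢ U := ⟨mem_univ _, hq⟩
  have hs := contDiffOn_powerSum (c := hjTerm α H) (N := N) fun j _ => hS j
  have hP := contDiffOn_momentum hU (N := N) fun j _ => hS j
  have hsymm := isSymmSndFDerivAt_of_contDiffOn hO hs hqO
  have key : ∀ (e : ℝ × Rn n) (v : Rn n), inner ℝ (fderiv ℝ (momentum α H N) q e) v =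
      fderiv ℝ (fderiv ℝ (powerSum (hjTerm α H) N)) q e (0, v) := by
    intro e v
    have h1 := (hasFDerivAt_of_contDiffOn hO hP hqO).inner ℝ (hasFDerivAt_const v q)
    have h2 := hasFDerivAt_fderiv_apply hO hs hqO ((0 : ℝ), v)
    have he : (fun p => inner ℝ (momentum α H N p) v) =ᶠ[𝓝 q]
        fun p => fderiv ℝ (powerSum (hjTerm α H) N) p (0, v) := by
      filter_upwards [hO.mem_nhds hqO] with p hp
        using inner_momentum hS hU N hp.2 v
    have h3 := congrArg (fun L => L e) (h1.unique (h2.congr_of_eventuallyEq he))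
    simpa using h3
  have hspace : ∀ v, spaceDeriv (momentum α H N) q v = fderiv ℝ (momentum α H N) q (0, v) :=
    fun v => by rw [fderiv_apply_eq hO hP hqO]; simp
  refine ⟨fun u v => ?_, fun v => ?_⟩
  · rw [hspace, hspace, key, key]
    exact hsymm.eq _ _
  · rw [timeDeriv_eq hO hP hqO, key, hsymm.eq, spaceDeriv_eq hO (contDiffOn_timeDeriv hO hs) hqO]
    have : timeDeriv (powerSum (hjTerm α H) N) =ᶠ[𝓝 q]
        fun p => fderiv ℝ (powerSum (hjTerm α H) N) p (1, 0) := by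
      filter_upwards [hO.mem_nhds hqO] with p hp using timeDeriv_eq hO hs hp
    rw [this.fderiv_eq, (hasFDerivAt_fderiv_apply hO hs hqO _).fderiv]
    simp

end HamiltonJacobi

/-! ### Perturbed integral curves -/

section Gronwall

variable {E : Type} [NormedAddCommGroup E] [NormedSpace ℝ E]

/-- A two-sided form of Grönwall's inequality for curves starting at `0`, whose velocity has an
inhomogeneous part of size `|t|ᵏ`. -/
theorem norm_le_of_norm_deriv_le {e e' : ℝ → E} {K C T : ℝ} {k : ℕ} (hK : 0 < K) (hC : 0 ≤ C)
    (hKT : K * |T| ≤ 1) (he : ∀ t, |t| ≤ |T| → HasDerivAt e (e' t) t) (h0 : e 0 = 0)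
    (hbound : ∀ t, |t| ≤ |T| → ‖e' t‖ ≤ K * ‖e t‖ + C * |t| ^ k) :
    ‖e T‖ ≤ 2 * C * |T| ^ (k + 1) := by
  rcases eq_or_ne T 0 with rfl | hT
  · simp [h0]
  have hT' : 0 < |T| := abs_pos.2 hT
  -- reparametrising by `s ↦ s * T` on `[0, 1]` treats both signs of `T` at once
  have hmem : ∀ s ∈ Icc (0 : ℝ) 1, |s * T| ≤ |T| := fun s hs => by
    rw [abs_mul, abs_of_nonneg hs.1]
    exact mul_le_of_le_one_left (abs_nonneg _) hs.2
  have hd : ∀ s ∈ Icc (0 : ℝ) 1, HasDerivAt (fun s => e (s * T)) (T • e' (s * T)) s := by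
    intro s hs
    have h1 : HasDerivAt (fun s : ℝ => s * T) T s := by simpa using (hasDerivAt_id s).mul_const T
    exact (he _ (hmem s hs)).scomp s h1
  have hg := norm_le_gronwallBound_of_norm_deriv_right_le (f := fun s => e (s * T))
    (f' := fun s => T • e' (s * T)) (δ := 0) (K := |T| * K) (ε := C * |T| ^ (k + 1)) (a := 0)
    (b := 1) (fun s hs => (hd s hs).continuousAt.continuousWithinAt)
    (fun s hs => (hd s (Ico_subset_Icc_self hs)).hasDerivWithinAt) (by simp [h0])
    (fun s hs => by
      have hs' := hmem s (Ico_subset_Icc_self hs)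
      have h1 := hbound _ hs'
      have h2 : C * |s * T| ^ k ≤ C * |T| ^ k := by gcongr
      rw [norm_smul, Real.norm_eq_abs]
      calc |T| * ‖e' (s * T)‖ ≤ |T| * (K * ‖e (s * T)‖ + C * |T| ^ k) := by gcongr; linarith
        _ = _ := by ring) 1 (right_mem_Icc.2 zero_le_one)
  have hTK : |T| * K ≠ 0 := by positivity
  rw [gronwallBound_of_K_ne_0 hTK] at hg
  have hexp := Real.abs_exp_sub_one_le (x := |T| * K)
    (by rw [abs_of_pos (by positivity)]; linarith)
  rw [abs_of_pos (by positivity : 0 < |T| * K)] at hexp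
  calc ‖e T‖ ≤ C * |T| ^ (k + 1) / (|T| * K) * (Real.exp (|T| * K) - 1) := by simpa using hg
    _ ≤ C * |T| ^ (k + 1) / (|T| * K) * (2 * (|T| * K)) := by
      gcongr
      exact (le_abs_self _).trans hexp
    _ = 2 * C * |T| ^ (k + 1) := by field_simp

/-- A curve whose velocity is `X` up to `O(tᵏ)` agrees with the integral curve of `X` up to
`o(tᵏ)`. -/
theorem isLittleO_sub_of_perturbed {X : E → E} {x : E} (hX : ContDiffAt ℝ 1 X x) {p c r : ℝ → E}
    {k : ℕ} (hp0 : p 0 = x) (hc0 : c 0 = x)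
    (hp : ∀ᶠ t in 𝓝 (0 : ℝ), HasDerivAt p (X (p t) + r t) t)
    (hc : ∀ᶠ t in 𝓝 (0 : ℝ), HasDerivAt c (X (c t)) t)
    (hr : r =O[𝓝 (0 : ℝ)] fun t => t ^ k) :
    (fun t => p t - c t) =o[𝓝 (0 : ℝ)] fun t => t ^ k := by
  -- `X` is Lipschitz near `x`, and both curves stay there for small times
  obtain ⟨L, N, hN, hL⟩ := hX.exists_lipschitzOnWith
  obtain ⟨C, hC0, hC⟩ := hr.exists_nonneg
  have hpN : ∀ᶠ t in 𝓝 (0 : ℝ), p t ∈ N :=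
    hp.self_of_nhds.continuousAt.eventually_mem (by rwa [hp0])
  have hcN : ∀ᶠ t in 𝓝 (0 : ℝ), c t ∈ N :=
    hc.self_of_nhds.continuousAt.eventually_mem (by rwa [hc0])
  obtain ⟨δ, hδ, hall⟩ := Metric.eventually_nhds_iff_ball.1
    (hp.and (hc.and (hpN.and (hcN.and hC.bound))))
  have hO : (fun t => p t - c t) =O[𝓝 (0 : ℝ)] fun t => t ^ (k + 1) := by
    refine IsBigO.of_bound (2 * C) ?_
    have hKt : ∀ᶠ t in 𝓝 (0 : ℝ), ((L : ℝ) + 1) * |t| < 1 := by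
      have : Filter.Tendsto (fun t : ℝ => ((L : ℝ) + 1) * |t|) (𝓝 0) (𝓝 (((L : ℝ) + 1) * |0|)) :=
        (continuous_const.mul continuous_abs).tendsto 0
      exact this.eventually_lt_const (by simp)
    filter_upwards [hKt, Metric.ball_mem_nhds _ hδ] with T hT hTδ
    have hmem : ∀ t, |t| ≤ |T| → t ∈ Metric.ball (0 : ℝ) δ := fun t ht => by
      simp only [Metric.mem_ball, dist_zero_right, Real.norm_eq_abs] at hTδ ⊢
      exact ht.trans_lt hTδ
    rw [norm_pow, Real.norm_eq_abs]
    refine norm_le_of_norm_deriv_le (e := fun t => p t - c t) (K := L + 1) (by positivity) hC0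
      hT.le (fun t ht => (hall t (hmem t ht)).1.sub (hall t (hmem t ht)).2.1)
      (by simp [hp0, hc0]) fun t ht => ?_
    obtain ⟨-, -, h1, h2, h3⟩ := hall t (hmem t ht)
    have h4 := hL.norm_sub_le h1 h2
    rw [norm_pow, Real.norm_eq_abs] at h3
    calc ‖X (p t) + r t - X (c t)‖ = ‖(X (p t) - X (c t)) + r t‖ := by congr 1; abel
      _ ≤ L * ‖p t - c t‖ + C * |t| ^ k := (norm_add_le _ _).trans (add_le_add h4 h3)
      _ ≤ _ := by gcongr; linarith
  refine hO.trans_isLittleO ?_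
  have h1 : (fun t : ℝ => t) =o[𝓝 (0 : ℝ)] fun _ => (1 : ℝ) :=
    (isLittleO_one_iff ℝ).2 Filter.tendsto_id
  simpa [pow_succ] using (isBigO_refl (fun t : ℝ => t ^ k) (𝓝 0)).mul_isLittleO h1

end Gronwall

/-! ### The scheme as a Hamiltonian flow -/

section Scheme

variable {n : ℕ} {U : Set (Rn n)} {π : Rn n → Matrix (Fin n) (Fin n) ℝ}
  {W : Set (Rn n × Rn n)} {α β : Rn n × Rn n → Rn n} {H : Rn n → ℝ} {k : ℕ}
  {V D E : Set (ℝ × Rn n)} {Y Z : ℝ × Rn n → Rn n}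

/-- The restriction of `f` to the graph of the momentum, parametrised by time and base point. -/
noncomputable def graphMap (α : Rn n × Rn n → Rn n) (H : Rn n → ℝ) (k : ℕ)
    (f : Rn n × Rn n → Rn n) (q : ℝ × Rn n) : Rn n :=
  f (q.2, momentum α H (k + 1) q)

/-- The truncated generating function `∂_t S = ∑_{1 ≤ i ≤ k} (tⁱ⁻¹ / (i-1)!) S_i`. -/
noncomputable def generatingRate (α : Rn n × Rn n → Rn n) (H : Rn n → ℝ) (k : ℕ) :
    ℝ × Rn n → ℝ :=
  timeDeriv (powerSum (hjTerm α H) (k + 1))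

theorem graphMap_zero_time {f : Rn n × Rn n → Rn n} (hf : ∀ x ∈ U, f (x, 0) = x) {y : Rn n}
    (hy : y ∈ U) : graphMap α H k f (0, y) = y := by
  rw [graphMap, momentum_zero_time, hf y hy]

/-- The hypotheses of the construction: `V` is a neighbourhood of `{0} × U` on which the source and
target maps of the graph of the momentum are invertible, with inverses `Y` and `Z`. -/
structure IsSchemeInverse (U : Set (Rn n)) (W : Set (Rn n × Rn n)) (α β : Rn n × Rn n → Rn n)
    (H : Rn n → ℝ) (k : ℕ) (V D E : Set (ℝ × Rn n)) (Y Z : ℝ × Rn n → Rn n) : Prop where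
  zeroNhd : IsZeroNhd U V
  subset : V ⊆ momentumDomain U W α H (k + 1)
  source : IsFamilyInverse (graphMap α H k α) V D Y
  target : IsFamilyInverse (graphMap α H k β) V E Z

theorem exists_isSchemeInverse (hW : IsBiRealisation U π W α β) (hU : IsOpen U)
    (hH : ContDiffOn ℝ ∞ H U) (k : ℕ) :
    ∃ V D E Y Z, IsSchemeInverse U W α β H k V D E Y Z := by
  have hS := contDiffOn_hjTerm hW hU hH
  have hO := isZeroNhd_momentumDomain hW hU (N := k + 1) fun j _ => hS j
  have hA := contDiffOn_comp_momentum (N := k + 1) hW.smooth_source hU fun j _ => hS j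
  have hB := contDiffOn_comp_momentum (N := k + 1) hW.smooth_target hU fun j _ => hS j
  obtain ⟨V₁, hV₁O, hV₁, hinj₁, hinv₁⟩ := exists_zeroNhd_injOn (G := graphMap α H k α) hU hO hA
    fun y hy => graphMap_zero_time hW.source_zero hy
  obtain ⟨V₂, hV₂O, hV₂, hinj₂, hinv₂⟩ := exists_zeroNhd_injOn (G := graphMap α H k β) hU hO hB
    fun y hy => graphMap_zero_time hW.target_zero hy
  have hopen := hV₁.isOpen.inter hV₂.isOpen
  obtain ⟨D, Y, hY⟩ := exists_isFamilyInverse hopen (hA.mono (inter_subset_left.trans hV₁O))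
    (hinj₁.mono inter_subset_left) fun q hq => hinv₁ q hq.1
  obtain ⟨E, Z, hZ⟩ := exists_isFamilyInverse hopen (hB.mono (inter_subset_left.trans hV₁O))
    (hinj₂.mono inter_subset_right) fun q hq => hinv₂ q hq.2
  exact ⟨V₁ ∩ V₂, D, E, Y, Z, ⟨hopen, fun z hz => ⟨hV₁.zero_mem z hz, hV₂.zero_mem z hz⟩⟩,
    inter_subset_left.trans hV₁O, hY, hZ⟩

/-- The step `φ_t(x)` of the scheme. -/
noncomputable def schemeStep (α β : Rn n × Rn n → Rn n) (H : Rn n → ℝ) (k : ℕ)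
    (Y : ℝ × Rn n → Rn n) (q : ℝ × Rn n) : Rn n :=
  graphMap α H k β (q.1, Y q)

/-- The Hamiltonian of the scheme: `∂_t S` transported by the target map. -/
noncomputable def schemeHamiltonian (α : Rn n × Rn n → Rn n) (H : Rn n → ℝ) (k : ℕ)
    (Z : ℝ × Rn n → Rn n) (q : ℝ × Rn n) : ℝ :=
  generatingRate α H k (q.1, Z q)

namespace IsSchemeInverse

/-- The step `B_t ∘ A_t⁻¹` maps the image of `A_t` to the image of `B_t`; by `step_inv` and
`inv_map`, its inverse is `A_t ∘ B_t⁻¹`. -/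
theorem step_map (h : IsSchemeInverse U W α β H k V D E Y Z) {q : ℝ × Rn n} (hq : q ∈ D) :
    (q.1, schemeStep α β H k Y q) ∈ E ∧ Z (q.1, schemeStep α β H k Y q) = Y q :=
  ⟨h.target.map_left _ (h.source.map_right q hq), h.target.left_inv _ (h.source.map_right q hq)⟩

theorem step_inv (h : IsSchemeInverse U W α β H k V D E Y Z) {q : ℝ × Rn n} (hq : q ∈ D) :
    graphMap α H k α (q.1, Z (q.1, schemeStep α β H k Y q)) = q.2 := by
  rw [(h.step_map hq).2, h.source.right_inv q hq]

theorem inv_map (h : IsSchemeInverse U W α β H k V D E Y Z) {q : ℝ × Rn n} (hq : q ∈ E) :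
    (q.1, graphMap α H k α (q.1, Z q)) ∈ D ∧
      schemeStep α β H k Y (q.1, graphMap α H k α (q.1, Z q)) = q.2 := by
  have h1 := h.target.map_right q hq
  refine ⟨h.source.map_left _ h1, ?_⟩
  have h2 := h.source.left_inv _ h1
  unfold schemeStep
  dsimp only at h2 ⊢
  rw [h2, h.target.right_inv q hq]

theorem contDiffOn_step (h : IsSchemeInverse U W α β H k V D E Y Z) :
    ContDiffOn ℝ ∞ (schemeStep α β H k Y) D :=
  h.target.smooth_left.comp (contDiffOn_fst.prodMk h.source.smooth_right) h.source.map_right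

theorem contDiffOn_inv (h : IsSchemeInverse U W α β H k V D E Y Z) :
    ContDiffOn ℝ ∞ (fun q => graphMap α H k α (q.1, Z q)) E :=
  h.source.smooth_left.comp (contDiffOn_fst.prodMk h.target.smooth_right) h.target.map_right

theorem contDiffOn_generatingRate (h : IsSchemeInverse U W α β H k V D E Y Z) (hU : IsOpen U)
    (hS : ∀ j, ContDiffOn ℝ ∞ (hjTerm α H j) U) :
    ContDiffOn ℝ ∞ (generatingRate α H k) V :=
  (contDiffOn_timeDeriv (isOpen_univ.prod hU) (contDiffOn_powerSum fun j _ => hS j)).mono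
    (h.subset.trans (momentumDomain_subset _))

theorem contDiffOn_hamiltonian (h : IsSchemeInverse U W α β H k V D E Y Z) (hU : IsOpen U)
    (hS : ∀ j, ContDiffOn ℝ ∞ (hjTerm α H j) U) :
    ContDiffOn ℝ ∞ (schemeHamiltonian α H k Z) E :=
  (h.contDiffOn_generatingRate hU hS).comp
    (contDiffOn_fst.prodMk h.target.smooth_right) h.target.map_right

theorem source_mem (h : IsSchemeInverse U W α β H k V D E Y Z)
    (hW : IsBiRealisation U π W α β) {q : ℝ × Rn n} (hq : q ∈ D) : q.2 ∈ U := by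
  rw [← h.source.right_inv q hq]
  exact hW.source_mem (h.subset (h.source.map_right q hq)).2

theorem target_mem (h : IsSchemeInverse U W α β H k V D E Y Z)
    (hW : IsBiRealisation U π W α β) {q : ℝ × Rn n} (hq : q ∈ E) : q.2 ∈ U := by
  rw [← h.target.right_inv q hq]
  exact hW.target_mem (h.subset (h.target.map_right q hq)).2

theorem step_zero_time (h : IsSchemeInverse U W α β H k V D E Y Z)
    (hW : IsBiRealisation U π W α β) {x : Rn n} (hx : x ∈ U) :
    schemeStep α β H k Y (0, x) = x := by
  unfold schemeStep
  rw [h.source.zero_time h.zeroNhd (fun y hy => graphMap_zero_time hW.source_zero hy) hx]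
  exact graphMap_zero_time hW.target_zero hx

theorem inv_zero_time (h : IsSchemeInverse U W α β H k V D E Y Z)
    (hW : IsBiRealisation U π W α β) {x : Rn n} (hx : x ∈ U) :
    graphMap α H k α (0, Z (0, x)) = x := by
  rw [h.target.zero_time h.zeroNhd (fun y hy => graphMap_zero_time hW.target_zero hy) hx]
  exact graphMap_zero_time hW.source_zero hx

theorem isZeroNhd_source (h : IsSchemeInverse U W α β H k V D E Y Z)
    (hW : IsBiRealisation U π W α β) : IsZeroNhd U D :=
  h.source.isZeroNhd h.zeroNhd fun _ hy => graphMap_zero_time hW.source_zero hy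

theorem isZeroNhd_target (h : IsSchemeInverse U W α β H k V D E Y Z)
    (hW : IsBiRealisation U π W α β) : IsZeroNhd U E :=
  h.target.isZeroNhd h.zeroNhd fun _ hy => graphMap_zero_time hW.target_zero hy

end IsSchemeInverse

/-- The derivatives of a map restricted to the moving graph: space derivatives are taken along the
tangent vectors `(v, Bv)` of the graph, and the velocity of a moving point `(u, Bu + l)` includes the
velocity `l` of the graph itself. -/
theorem fderiv_graphMap (hW : IsOpen W) (hU : IsOpen U)
    (hO : IsZeroNhd U (momentumDomain U W α H (k + 1)))
    (hS : ∀ j, ContDiffOn ℝ ∞ (hjTerm α H j) U) {f : Rn n × Rn n → Rn n}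
    (hf : ContDiffOn ℝ ∞ f W) {p : ℝ × Rn n} (hp : p ∈ momentumDomain U W α H (k + 1)) :
    (∀ v, spaceDeriv (graphMap α H k f) p v = fderiv ℝ f (p.2, momentum α H (k + 1) p)
      (v, spaceDeriv (momentum α H (k + 1)) p v)) ∧
    ∀ u, timeDeriv (graphMap α H k f) p + spaceDeriv (graphMap α H k f) p u =
      fderiv ℝ f (p.2, momentum α H (k + 1) p)
        (u, spaceDeriv (momentum α H (k + 1)) p u + timeDeriv (momentum α H (k + 1)) p) := by
  have hG : ContDiffOn ℝ ∞ (graphMap α H k f) (momentumDomain U W α H (k + 1)) :=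
    contDiffOn_comp_momentum hf hU fun j _ => hS j
  have hP := contDiffOn_momentum hU (N := k + 1) fun j _ => hS j
  have hOU := isOpen_univ.prod hU (X := ℝ)
  have hpU : p ∈ (univ : Set ℝ) ×ˢ U := momentumDomain_subset _ hp
  have key : ∀ s u, fderiv ℝ (graphMap α H k f) p (s, u) =
      fderiv ℝ f (p.2, momentum α H (k + 1) p)
        (u, s • timeDeriv (momentum α H (k + 1)) p + spaceDeriv (momentum α H (k + 1)) p u) := by
    intro s u
    have hd : HasFDerivAt (graphMap α H k f) _ p :=
      (hasFDerivAt_of_contDiffOn hW hf hp.2).comp p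
      (hasFDerivAt_snd.prodMk (hasFDerivAt_of_contDiffOn hOU hP hpU))
    rw [hd.fderiv, ← fderiv_apply_eq hOU hP hpU]
    rfl
  constructor
  · intro v
    have h1 := key 0 v
    rw [fderiv_apply_eq hO.isOpen hG hp] at h1
    simpa using h1
  · intro u
    have h1 := key 1 u
    rw [fderiv_apply_eq hO.isOpen hG hp] at h1
    simpa [add_comm] using h1

namespace IsSchemeInverse

/-- The step is the flow of the Hamiltonian of the scheme. -/
theorem timeDeriv_step (h : IsSchemeInverse U W α β H k V D E Y Z) (hπ : IsPoissonStructure U π)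
    (hW : IsBiRealisation U π W α β) (hU : IsOpen U) (hH : ContDiffOn ℝ ∞ H U) {q : ℝ × Rn n}
    (hq : q ∈ D) : timeDeriv (schemeStep α β H k Y) q =
      tensorMap π (schemeStep α β H k Y q)
        (spaceDeriv (schemeHamiltonian α H k Z) (q.1, schemeStep α β H k Y q)) := by
  have hS := contDiffOn_hjTerm hW hU hH
  have hO := isZeroNhd_momentumDomain hW hU (N := k + 1) fun j _ => hS j
  have hp := h.source.map_right q hq
  obtain ⟨hsA, htA⟩ := fderiv_graphMap hW.isOpen hU hO hS hW.smooth_source (h.subset hp)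
  obtain ⟨hsB, htB⟩ := fderiv_graphMap hW.isOpen hU hO hS hW.smooth_target (h.subset hp)
  obtain ⟨hsymm, hl⟩ := momentum_deriv hS hU (k + 1) (q := (q.1, Y q)) (h.subset hp).1
  have hVo := h.source.isOpen_left
  -- the source of the moving point of the graph stays at `q.2`
  have hsrc : timeDeriv (graphMap α H k α) (q.1, Y q) +
      spaceDeriv (graphMap α H k α) (q.1, Y q) (timeDeriv Y q) = 0 := by
    rw [← timeDeriv_comp_space hVo h.source.isOpen_right h.source.smooth_left
      h.source.smooth_right hq hp,
      timeDeriv_congr h.source.isOpen_right (g := fun q => q.2) h.source.right_inv hq]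
    exact deriv_const _ _
  have hinj : ∀ v, fderiv ℝ α (Y q, momentum α H (k + 1) (q.1, Y q))
      (v, spaceDeriv (momentum α H (k + 1)) (q.1, Y q) v) = 0 → v = 0 := by
    intro v hv
    have h1 := spaceDeriv_comp_space h.source.isOpen_right hVo h.source.smooth_right
      h.source.smooth_left hp (h.source.map_left _ hp)
    rw [spaceDeriv_congr hVo (g := fun q => q.2) h.source.left_inv hp] at h1
    have h2 : spaceDeriv (fun q : ℝ × Rn n => q.2) (q.1, Y q) v = v := by
      unfold spaceDeriv
      simp
    rw [← h2, h1, ContinuousLinearMap.comp_apply, hsA v, hv, map_zero]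
  have hη : ∀ v, spaceDeriv (schemeHamiltonian α H k Z) (q.1, schemeStep α β H k Y q)
      (fderiv ℝ β (Y q, momentum α H (k + 1) (q.1, Y q))
        (v, spaceDeriv (momentum α H (k + 1)) (q.1, Y q) v)) =
      inner ℝ (timeDeriv (momentum α H (k + 1)) (q.1, Y q)) v := by
    intro v
    have h1 := spaceDeriv_comp_space h.target.isOpen_right hVo (h.contDiffOn_hamiltonian hU hS)
      h.target.smooth_left hp (h.target.map_left _ hp)
    have h2 : ∀ p ∈ V, schemeHamiltonian α H k Z (p.1, graphMap α H k β p) =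
        generatingRate α H k p := fun p hp => by
      rw [schemeHamiltonian, h.target.left_inv p hp]
    rw [spaceDeriv_congr hVo h2 hp] at h1
    rw [hl, ← hsB v]
    exact (congrArg (fun L => L v) h1).symm
  have hvel := hW.target_velocity hπ (h.subset hp).2 hsymm hinj
    (u := timeDeriv Y q) (by rw [← htA, hsrc]) hη
  rw [← htB] at hvel
  rw [← show _ = timeDeriv (schemeStep α β H k Y) q from
    (timeDeriv_comp_space hVo h.source.isOpen_right h.target.smooth_left
      h.source.smooth_right hq hp).symm]
  exact hvel

/-- The step is a Poisson map. -/
theorem apply_tensorMap_step (h : IsSchemeInverse U W α β H k V D E Y Z)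
    (hW : IsBiRealisation U π W α β) (hU : IsOpen U) (hH : ContDiffOn ℝ ∞ H U) {q : ℝ × Rn n}
    (hq : q ∈ D) (ξ η : Rn n →L[ℝ] ℝ) :
    ξ (spaceDeriv (schemeStep α β H k Y) q
      (tensorMap π q.2 (η.comp (spaceDeriv (schemeStep α β H k Y) q)))) =
      ξ (tensorMap π (schemeStep α β H k Y q) η) := by
  have hS := contDiffOn_hjTerm hW hU hH
  have hO := isZeroNhd_momentumDomain hW hU (N := k + 1) fun j _ => hS j
  have hp := h.source.map_right q hq
  obtain ⟨hsA, -⟩ := fderiv_graphMap hW.isOpen hU hO hS hW.smooth_source (h.subset hp)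
  obtain ⟨hsB, -⟩ := fderiv_graphMap hW.isOpen hU hO hS hW.smooth_target (h.subset hp)
  obtain ⟨hsymm, -⟩ := momentum_deriv hS hU (k + 1) (q := (q.1, Y q)) (h.subset hp).1
  have hVo := h.source.isOpen_left
  have hA : graphMap α H k α (q.1, Y q) = q.2 := h.source.right_inv q hq
  have hM : ∀ v, spaceDeriv (schemeStep α β H k Y) q
      (fderiv ℝ α (Y q, momentum α H (k + 1) (q.1, Y q))
        (v, spaceDeriv (momentum α H (k + 1)) (q.1, Y q) v)) =
      fderiv ℝ β (Y q, momentum α H (k + 1) (q.1, Y q))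
        (v, spaceDeriv (momentum α H (k + 1)) (q.1, Y q) v) := by
    intro v
    have h1 := spaceDeriv_comp_space h.source.isOpen_right hVo h.contDiffOn_step
      h.source.smooth_left hp (h.source.map_left _ hp)
    have h2 : ∀ p ∈ V, schemeStep α β H k Y (p.1, graphMap α H k α p) =
        graphMap α H k β p := fun p hp => by
      rw [schemeStep, h.source.left_inv p hp]
    rw [spaceDeriv_congr hVo h2 hp] at h1
    have h3 := congrArg (fun L => L v) h1
    dsimp only at h3
    rw [ContinuousLinearMap.comp_apply, hA] at h3
    rw [← hsB v, ← hsA v]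
    exact h3.symm
  have := hW.apply_tensorMap_of_graph (h.subset hp).2 hsymm hM ξ η
  rw [show α ((q.1, Y q).2, momentum α H (k + 1) (q.1, Y q)) = q.2 from hA] at this
  exact this

end IsSchemeInverse

end Scheme

/-! ### Order of the scheme -/

section Order

variable {n : ℕ} {U : Set (Rn n)} {π : Rn n → Matrix (Fin n) (Fin n) ℝ}
  {W : Set (Rn n × Rn n)} {α β : Rn n × Rn n → Rn n} {H : Rn n → ℝ} {k : ℕ}
  {V D E : Set (ℝ × Rn n)} {Y Z : ℝ × Rn n → Rn n}

theorem spaceDeriv_hamiltonian_sub {K : ℝ × Rn n → ℝ} (hU : IsOpen U) (hE : IsOpen E)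
    (hK : ContDiffOn ℝ ∞ K E) (hH : ContDiffOn ℝ ∞ H U) {q : ℝ × Rn n} (hq : q ∈ E)
    (hqU : q.2 ∈ U) : spaceDeriv (fun q => K q - H q.2) q = spaceDeriv K q - fderiv ℝ H q.2 :=
  ((hasFDerivAt_spaceDeriv hE hK hq).sub (hasFDerivAt_of_contDiffOn hU hH hqU)).fderiv

/-- The Hamiltonian of the scheme agrees with `H` to order `k`. Along the step, their difference is
`(∂_t S - H ∘ α) + (H ∘ α - H ∘ β)`. The first term is controlled by the truncated Hamilton-Jacobi
equation; the second has time derivative `d(K - H)(X_H)`, since `dH(X_H) = 0`, and so gains one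
order over `K - H`. -/
theorem IsSchemeInverse.vanishesToOrder (h : IsSchemeInverse U W α β H k V D E Y Z)
    (hπ : IsPoissonStructure U π) (hW : IsBiRealisation U π W α β) (hU : IsOpen U)
    (hH : ContDiffOn ℝ ∞ H U) :
    VanishesToOrder U k (fun q => schemeHamiltonian α H k Z q - H q.2) := by
  have hS := contDiffOn_hjTerm hW hU hH
  have hD := h.isZeroNhd_source hW
  have hE := h.isZeroNhd_target hW
  have hK := h.contDiffOn_hamiltonian hU hS
  have hHE : ContDiffOn ℝ ∞ (fun q : ℝ × Rn n => H q.2) E :=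
    hH.comp contDiffOn_snd fun q hq => h.target_mem hW hq
  have hHD : ContDiffOn ℝ ∞ (fun q : ℝ × Rn n => H q.2) D :=
    hH.comp contDiffOn_snd fun q hq => h.source_mem hW hq
  have hφE : ∀ q ∈ D, (q.1, schemeStep α β H k Y q) ∈ E := fun q hq => (h.step_map hq).1
  have hHφ : ContDiffOn ℝ ∞ (fun q => H (schemeStep α β H k Y q)) D :=
    hH.comp h.contDiffOn_step fun q hq => h.target_mem hW (hφE q hq)
  set e : ℝ × Rn n → ℝ := fun q => schemeHamiltonian α H k Z q - H q.2 with he_def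
  have he : ContDiffOn ℝ ∞ e E := hK.sub hHE
  -- the Hamiltonian vector field of `H`
  let X : ℝ × Rn n → Rn n := fun q => tensorMap π q.2 (fderiv ℝ H q.2)
  have hX : ContDiffOn ℝ ∞ X E :=
    ((contDiffOn_tensorMap hπ).clm_apply (hH.fderiv_of_isOpen hU (m := ∞) (by simp))).comp
      contDiffOn_snd fun q hq => h.target_mem hW hq
  have hHα : ContDiffOn ℝ ∞ (fun q => H (graphMap α H k α q)) V :=
    hH.comp h.source.smooth_left fun q hq => hW.source_mem (h.subset hq).2
  have hHJ : VanishesToOrder U k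
      (fun q => generatingRate α H k (q.1, Y q) - H (graphMap α H k α (q.1, Y q))) :=
    VanishesToOrder.comp_space hU h.zeroNhd hD ((h.contDiffOn_generatingRate hU hS).sub hHα)
      h.source.smooth_right h.source.map_right
      (fun z hz => h.source.zero_time h.zeroNhd
        (fun y hy => graphMap_zero_time hW.source_zero hy) hz)
      (vanishesToOrder_hamiltonJacobi hW hU hH k)
  have hHJ' : ContDiffOn ℝ ∞
      (fun q => generatingRate α H k (q.1, Y q) - H (graphMap α H k α (q.1, Y q))) D :=
    ((h.contDiffOn_generatingRate hU hS).sub hHα).comp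
      (contDiffOn_fst.prodMk h.source.smooth_right) h.source.map_right
  have key : ∀ j ≤ k, VanishesToOrder U j e := by
    intro j
    induction j with
    | zero => exact fun _ => vanishesToOrder_zero _ _
    | succ j ih =>
      intro hj
      have ihj := ih (by omega)
      have hdrift : VanishesToOrder U (j + 1)
          (fun q : ℝ × Rn n => H q.2 - H (schemeStep α β H k Y q)) := by
        rw [vanishesToOrder_succ]
        refine ⟨fun z hz => by simp [h.step_zero_time hW hz], ?_⟩
        let B : (Rn n →L[ℝ] ℝ) →L[ℝ] Rn n →L[ℝ] ℝ := ContinuousLinearMap.id ℝ _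
        have h1 : VanishesToOrder U j fun q => B (spaceDeriv e q) (X q) :=
          VanishesToOrder.bilin_left hE B (contDiffOn_spaceDeriv hE.isOpen he) hX
            (ihj.spaceDeriv hU hE he)
        have h2 := VanishesToOrder.comp_space hU hE hD
          (contDiffOn_bilin B (contDiffOn_spaceDeriv hE.isOpen he) hX) h.contDiffOn_step hφE
          (fun z hz => h.step_zero_time hW hz) h1
        refine h2.congr hD fun q hq => ?_
        have hqU := h.target_mem hW (hφE q hq)
        have hd := ((hasDerivAt_const q.1 (H q.2)).sub
          ((hasFDerivAt_of_contDiffOn hU hH hqU).comp_hasDerivAt q.1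
            (hasDerivAt_timeDeriv hD.isOpen h.contDiffOn_step hq))).deriv
        change spaceDeriv e (q.1, schemeStep α β H k Y q) (X (q.1, schemeStep α β H k Y q)) = _
        refine Eq.trans ?_ hd.symm
        rw [h.timeDeriv_step hπ hW hU hH hq, apply_tensorMap_skew hπ hqU,
          spaceDeriv_hamiltonian_sub hU hE.isOpen hK hH (hφE q hq) hqU, map_sub, map_sub]
        have h3 := apply_tensorMap_skew hπ hqU (fderiv ℝ H (schemeStep α β H k Y q))
          (fderiv ℝ H (schemeStep α β H k Y q))
        dsimp only [X] at h3 ⊢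
        linarith
      have hsum : VanishesToOrder U (j + 1) fun q => e (q.1, schemeStep α β H k Y q) := by
        refine ((hHJ.mono hj).add hD hHJ' (hHD.sub hHφ) hdrift).congr hD fun q hq => ?_
        simp only [he_def, schemeHamiltonian, (h.step_map hq).2, h.source.right_inv q hq]
        ring
      refine (VanishesToOrder.comp_space hU hD hE
        (he.comp (contDiffOn_fst.prodMk h.contDiffOn_step) hφE) h.contDiffOn_inv
        (fun q hq => (h.inv_map hq).1) (fun z hz => h.inv_zero_time hW hz) hsum).congr hE
          fun q hq => ?_
      change e (q.1, schemeStep α β H k Y (q.1, graphMap α H k α (q.1, Z q))) = e q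
      rw [(h.inv_map hq).2]
  exact key k le_rfl

/-- The difference between the Hamiltonian vector fields of the scheme and of `H`. -/
noncomputable def velocityError (π : Rn n → Matrix (Fin n) (Fin n) ℝ) (α : Rn n × Rn n → Rn n)
    (H : Rn n → ℝ) (k : ℕ) (Z : ℝ × Rn n → Rn n) (q : ℝ × Rn n) : Rn n :=
  tensorMap π q.2 (spaceDeriv (fun q => schemeHamiltonian α H k Z q - H q.2) q)

theorem IsSchemeInverse.velocityError_vanishesToOrder
    (h : IsSchemeInverse U W α β H k V D E Y Z)
    (hπ : IsPoissonStructure U π) (hW : IsBiRealisation U π W α β) (hU : IsOpen U)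
    (hH : ContDiffOn ℝ ∞ H U) : ContDiffOn ℝ ∞ (velocityError π α H k Z) E ∧
      VanishesToOrder U k (velocityError π α H k Z) := by
  have hE := h.isZeroNhd_target hW
  have he : ContDiffOn ℝ ∞ (fun q => schemeHamiltonian α H k Z q - H q.2) E :=
    (h.contDiffOn_hamiltonian hU (contDiffOn_hjTerm hW hU hH)).sub
      (hH.comp contDiffOn_snd fun q hq => h.target_mem hW hq)
  have hde := contDiffOn_spaceDeriv hE.isOpen he
  have htensor : ContDiffOn ℝ ∞ (fun q : ℝ × Rn n => tensorMap π q.2) E :=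
    (contDiffOn_tensorMap hπ).comp contDiffOn_snd fun q hq => h.target_mem hW hq
  exact ⟨htensor.clm_apply hde, VanishesToOrder.bilin_right hE
    (ContinuousLinearMap.id ℝ ((Rn n →L[ℝ] ℝ) →L[ℝ] Rn n)) htensor hde
    ((h.vanishesToOrder hπ hW hU hH).spaceDeriv hU hE he)⟩

theorem IsSchemeInverse.timeDeriv_step_eq_add (h : IsSchemeInverse U W α β H k V D E Y Z)
    (hπ : IsPoissonStructure U π) (hW : IsBiRealisation U π W α β) (hU : IsOpen U)
    (hH : ContDiffOn ℝ ∞ H U) {q : ℝ × Rn n} (hq : q ∈ D) :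
    timeDeriv (schemeStep α β H k Y) q = hamVF π H (schemeStep α β H k Y q) +
      velocityError π α H k Z (q.1, schemeStep α β H k Y q) := by
  have hφE := (h.step_map hq).1
  rw [h.timeDeriv_step hπ hW hU hH hq, hamVF_eq, velocityError, spaceDeriv_hamiltonian_sub hU
    h.target.isOpen_right (h.contDiffOn_hamiltonian hU (contDiffOn_hjTerm hW hU hH)) hH hφE
    (h.target_mem hW hφE), map_sub]
  abel

theorem IsSchemeInverse.isLittleO_step (h : IsSchemeInverse U W α β H k V D E Y Z)
    (hπ : IsPoissonStructure U π) (hW : IsBiRealisation U π W α β) (hU : IsOpen U)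
    (hH : ContDiffOn ℝ ∞ H U) {x : Rn n} (hx : x ∈ U) {c : ℝ → Rn n} (hc0 : c 0 = x)
    (hc : ∀ᶠ t in 𝓝 (0 : ℝ), HasDerivAt c (hamVF π H (c t)) t) :
    (fun t => schemeStep α β H k Y (t, x) - c t) =o[𝓝 (0 : ℝ)] fun t => t ^ k := by
  have hD := h.isZeroNhd_source hW
  have hE := h.isZeroNhd_target hW
  have hφE : ∀ q ∈ D, (q.1, schemeStep α β H k Y q) ∈ E := fun q hq => (h.step_map hq).1
  obtain ⟨hR, hRv⟩ := h.velocityError_vanishesToOrder hπ hW hU hH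
  have hRφ := VanishesToOrder.comp_space hU hE hD hR h.contDiffOn_step hφE
    (fun z hz => h.step_zero_time hW hz) hRv
  have hRφs : ContDiffOn ℝ ∞
      (fun q => velocityError π α H k Z (q.1, schemeStep α β H k Y q)) D :=
    hR.comp (contDiffOn_fst.prodMk h.contDiffOn_step) hφE
  have htend : Filter.Tendsto (fun t : ℝ => (t, x)) (𝓝 0) (𝓝 (0, x)) :=
    (Continuous.prodMk_left x).tendsto 0
  have hO : (fun t : ℝ => velocityError π α H k Z (t, schemeStep α β H k Y (t, x)))
      =O[𝓝 (0 : ℝ)] fun t => t ^ k := (hRφ.isBigO hU hD hRφs hx).comp_tendsto htend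
  have hXs : ContDiffOn ℝ ∞ (hamVF π H) U :=
    ((contDiffOn_tensorMap hπ).clm_apply
      (hH.fderiv_of_isOpen hU (m := ∞) (by simp))).congr fun z _ => hamVF_eq π H z
  have hX1 : ContDiffAt ℝ 1 (hamVF π H) x :=
    (hXs.contDiffAt (hU.mem_nhds hx)).of_le (by exact_mod_cast le_top)
  refine isLittleO_sub_of_perturbed hX1 (p := fun t => schemeStep α β H k Y (t, x))
    (h.step_zero_time hW hx) hc0 ?_ hc hO
  filter_upwards [hD.eventually hx] with t ht
  exact (hasDerivAt_timeDeriv hD.isOpen h.contDiffOn_step ht).congr_deriv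
    (h.timeDeriv_step_eq_add hπ hW hU hH ht)

end Order

/-! ### The integrator -/

theorem mainTheorem1 (n k : ℕ) (hk : 1 ≤ k)
    (U : Set (Rn n)) (hU : IsOpen U)
    (π : Rn n → Matrix (Fin n) (Fin n) ℝ) (hπ : IsPoissonStructure U π)
    (W : Set (Rn n × Rn n)) (α β : Rn n × Rn n → Rn n) (hW : IsBiRealisation U π W α β)
    (H : Rn n → ℝ) (hH : ContDiffOn ℝ ∞ H U) :
    ∃ (V D : Set (ℝ × Rn n)) (Y φ : ℝ → Rn n → Rn n),
      IsOpen V ∧ (∀ x ∈ U, ((0 : ℝ), x) ∈ V) ∧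
      ContDiffOn ℝ ∞ (Function.uncurry Y) D ∧
      (∀ h x, (h, x) ∈ D →
        (h, Y h x) ∈ V ∧ SolvesImplicit W α H k h x (Y h x) ∧
        (∀ y, (h, y) ∈ V → SolvesImplicit W α H k h x y → y = Y h x) ∧
        φ h x = β (Y h x, schemeMomentum α H k h (Y h x))) ∧
      IsPoissonHamiltonianIntegrator U π H k D φ := by
  obtain ⟨V, D', E, Y, Z, h⟩ := exists_isSchemeInverse hW hU hH k
  have hS := contDiffOn_hjTerm hW hU hH
  have hD' := h.isZeroNhd_source hW
  have hE := h.isZeroNhd_target hW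
  have hK := h.contDiffOn_hamiltonian hU hS
  -- the part of the domain that is star-shaped in time
  let D : Set (ℝ × Rn n) := {q | ∀ s ∈ Icc (0 : ℝ) 1, (s * q.1, q.2) ∈ D'}
  have hDo : IsOpen D := isOpen_setOf_forall_smul_mem hD'.isOpen
  have hDD' : D ⊆ D' := fun q hq => by simpa using hq 1 (right_mem_Icc.2 zero_le_one)
  have hslice : ∀ t : ℝ, ContDiff ℝ ∞ fun x : Rn n => (t, x) :=
    fun t => contDiff_const.prodMk contDiff_id
  have himage : ∀ t, (fun x => schemeStep α β H k Y (t, x)) '' {x | (t, x) ∈ D} =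
      (fun z => (t, z)) ⁻¹' (E ∩ (fun q => (q.1, graphMap α H k α (q.1, Z q))) ⁻¹' D) := by
    intro t
    ext z
    constructor
    · rintro ⟨x, hx, rfl⟩
      refine ⟨(h.step_map (hDD' hx)).1, ?_⟩
      have := h.step_inv (hDD' hx)
      change (t, graphMap α H k α (t, Z (t, schemeStep α β H k Y (t, x)))) ∈ D
      rwa [this]
    · rintro ⟨hz, hzD⟩
      exact ⟨_, hzD, (h.inv_map hz).2⟩
  refine ⟨V, D, fun t x => Y (t, x), fun t x => schemeStep α β H k Y (t, x),
    h.zeroNhd.isOpen, h.zeroNhd.zero_mem, h.source.smooth_right.mono hDD', ?_, ?_⟩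
  · intro t x htx
    have hV := h.source.map_right _ (hDD' htx)
    refine ⟨hV, ?_, ?_, ?_⟩
    · unfold SolvesImplicit
      rw [schemeMomentum_eq]
      exact ⟨(h.subset hV).2, h.source.right_inv _ (hDD' htx)⟩
    · intro y hy hsol
      unfold SolvesImplicit at hsol
      rw [schemeMomentum_eq] at hsol
      have h1 : Y (t, α (y, momentum α H (k + 1) (t, y))) = y := h.source.left_inv _ hy
      rw [hsol.2] at h1
      exact h1.symm
    · rw [schemeMomentum_eq]
      rfl
  refine { isOpen := hDo, subset := fun q hq => h.source_mem hW (hDD' hq), zero_mem := ?_,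
           interval := ?_, smooth := h.contDiffOn_step.mono hDD', mapsTo := ?_, map_zero := ?_,
           diffeo := ?_, order := ?_, poisson := ?_, hamiltonian := ?_ }
  · intro x hx s _
    simpa using hD'.zero_mem x hx
  · intro t x htx s hs r hr
    have := htx (r * s) ⟨mul_nonneg hr.1 hs.1, mul_le_one₀ hr.2 hs.1 hs.2⟩
    simpa [mul_assoc] using this
  · exact fun t x htx => h.target_mem hW (h.step_map (hDD' htx)).1
  · exact fun x hx => h.step_zero_time hW hx
  · intro t
    refine ⟨h.contDiffOn_step.comp (hslice t).contDiffOn fun x hx => hDD' hx, ?_,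
      fun z => graphMap α H k α (t, Z (t, z)), ?_, fun x hx => h.step_inv (hDD' hx)⟩
    · rw [himage]
      exact ((contDiffOn_fst.prodMk h.contDiffOn_inv).continuousOn.isOpen_inter_preimage
        hE.isOpen hDo).preimage (hslice t).continuous
    · rw [himage]
      exact h.contDiffOn_inv.comp (hslice t).contDiffOn fun z hz => hz.1
  · exact fun x hx c hc0 hc => h.isLittleO_step hπ hW hU hH hx hc0 hc
  · intro F G hF hG t x htx
    have hφU := h.target_mem hW (h.step_map (hDD' htx)).1
    have hφ := hasFDerivAt_spaceDeriv hD'.isOpen h.contDiffOn_step (hDD' htx)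
    have hcomp : ∀ {F : Rn n → ℝ}, ContDiffOn ℝ ∞ F U →
        fderiv ℝ (F ∘ fun x => schemeStep α β H k Y (t, x)) x =
          (fderiv ℝ F (schemeStep α β H k Y (t, x))).comp
            (spaceDeriv (schemeStep α β H k Y) (t, x)) := fun hF =>
      (HasFDerivAt.comp x (hasFDerivAt_of_contDiffOn hU hF hφU) hφ).fderiv
    rw [bracket_eq, bracket_eq, hcomp hF, hcomp hG]
    exact h.apply_tensorMap_step hW hU hH (hDD' htx) _ _
  · refine ⟨E, fun t x => schemeHamiltonian α H k Z (t, x), hE.isOpen,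
      fun q hq => h.target_mem hW hq, hE.zero_mem, hK, fun t x htx =>
        ⟨(h.step_map (hDD' htx)).1, ?_⟩, fun x hx => ?_⟩
    · refine (hasDerivAt_timeDeriv hD'.isOpen h.contDiffOn_step (hDD' htx)).congr_deriv ?_
      rw [h.timeDeriv_step hπ hW hU hH (hDD' htx), hamVF_eq]
      rfl
    · exact (h.vanishesToOrder hπ hW hU hH).isBigO hU hE
        (hK.sub (hH.comp contDiffOn_snd fun q hq => h.target_mem hW hq)) hx
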